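/- **Setting.** Let $X\subset\mathbb{R}^{n_x}$ and $\Theta\subset\mathbb{R}^{n_p}$ be nonempty, compact and convex, let $T>0$ and $J\ge 1$, and let $\Gamma\subseteq[0,JT]$ be compact and convex. Let $f:[0,JT]\times\mathbb{R}^{n_x}\times\Theta\to\mathbb{R}^{n_x}$ and $g:\Gamma\times\mathbb{R}^{n_x}\times\Theta\to\mathbb{R}^{n_y}$ be $C^1$ functions whose partial derivatives $\nabla_x f,\nabla_\theta f,\nabla_x g,\nabla_\theta g$ are Lipschitz continuous on these domains (derivatives in $\theta$ are taken within $\Theta$). Put $a=2\sup_{x\in X}\|x\|_2$, $B_a=\{x:\|x\|_2\le a\}$, $$K_x=\sup_{t\in[0,JT],\,\theta\in\Theta,\,x\ne y\in B_a}\frac{\|f(t,x,\theta)-f(t,y,\theta)\|_2}{\|x-y\|_2},\qquad M=\sup_{t\in[0,JT],\,\theta\in\Theta,\,x\in B_a}\|f(t,x,\theta)\|_2,$$ and assume $T<\min\{1/K_x,\;a/(2M)\}$ (with $c/0=\infty$ for $c>0$ and $0/0=0$). Let $C_a$ be the set of continuous $u:[0,T]\to\mathbb{R}^{n_x}$ with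 $\|u\|_\infty=\sup_{t\in[0,T]}\|u(t)\|_2\le a$. For $u\in C([0,T],\mathbb{R}^{n_x})$ let $$(\mathcal P_{t_0,x,\theta}u)(t)=x+\int_0^t f(s+t_0,u(s),\theta)\,ds ,\qquad t\in[0,T].$$ Let $t_1,\dots,t_{N_s}\in\Gamma$ ($N_s\ge1$), $y_1,\dots,y_{N_s}\in\mathbb{R}^{n_y}$ and $\lambda>0$. For $t\in[0,JT]$ let $j(t)\in\{1,\dots,J\}$ be the index with $(j(t)-1)T\le t<j(t)T$, and $j(JT)=J$. For $m\in\mathbb{N}$, $x=(x_1,\dots,x_J)\in(\mathbb{R}^{n_x})^J$, $\theta\in\Theta$, $u=(u_1,\dots,u_J)\in C([0,T],\mathbb{R}^{n_x})^J$, put $v_j=\mathcal P^m_{(j-1)T,x_j,\theta}u_j$ and $$L_{\lambda,m}(x,\theta,u)=\lambda\sum_{j=1}^{J-1}\|v_j(T)-x_{j+1}\|_2^2+\frac1{2N_s}\sum_{i=1}^{N_s}\bigl\|y_i-g\bigl(t_i,\,v_{j(t_i)}(t_i-(j(t_i)-1)T),\,\theta\bigr)\bigr\|_2^2 .$$ Assume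 that there is $\mu>0$ such that for all $m\ge1$ and all $u\in C_a^J$ the function $(x,\theta)\mapsto L_{\lambda,m}(x,\theta,u)-\frac\mu2\bigl(\sum_j\|x_j\|_2^2+\|\theta\|_2^2\bigr)$ is convex on $X^J\times\Theta$. For $\alpha>0$, $\sigma\in(0,1]$ and $m\ge 1$ let $\hat{\mathcal T}(x,\theta,u)=(x^+,\theta^+,u^+)$, where $$x_j^+=\Pi_X[x_j-\alpha\nabla_{x_j}L_{\lambda,m}(x,\theta,u)],\quad \theta^+=\Pi_\Theta[\theta-\alpha\nabla_\theta L_{\lambda,m}(x,\theta,u)],\quad u_j^+=(1-\sigma)u_j+\sigma\,\mathcal P_{(j-1)T,x_j^+,\theta^+}u_j ,$$ $\Pi$ denotes the Euclidean nearest-point projection, and $\nabla_\theta$ is taken within $\Theta$. **Claim.** There exist $\alpha>0$, $\sigma\in(0,1]$, an order $m\ge1$, a rate $\nu\in[0,1)$ and a point $(x^*,\theta^*,u^*)\in X^J\times\Theta\times C_a^J$ which is the unique fixed point of $\hat{\mathcal T}$ in $X^J\times\Theta\times C_a^J$, such that for every $(x_0,\theta_0,u_0)\in X^J\times\Theta\times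 C_a^J$ the iterates $(x_k,\theta_k,u_k)=\hat{\mathcal T}^k(x_0,\theta_0,u_0)$ converge to $(x^*,\theta^*,u^*)$ and, for all $k\ge 0$, $$\|(x_k,\theta_k)-(x^*,\theta^*)\|_2+\|u_k-u^*\|_\infty\le\nu^k\bigl(\|(x_0,\theta_0)-(x^*,\theta^*)\|_2+\|u_0-u^*\|_\infty\bigr),$$ where $\|(x,\theta)\|_2=\bigl(\sum_j\|x_j\|_2^2+\|\theta\|_2^2\bigr)^{1/2}$ and $\|u\|_\infty=\max_j\|u_j\|_\infty$. -/

import Mathlib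

open Set Filter Topology
open scoped NNReal ENNReal

noncomputable section

namespace ParamEst

/-- Euclidean space of dimension `n`. -/
abbrev Euc (n : ℕ) : Type := EuclideanSpace ℝ (Fin n)

/-- Continuous `ℝⁿ`-valued functions on `[0, T]`, with the supremum norm. -/
abbrev Traj (T : ℝ) (n : ℕ) : Type := C(Icc (0 : ℝ) T, Euc n)

variable {n p q N J : ℕ} {T : ℝ}

/-- The radius `a = 2 sup_{x ∈ X} ‖x‖`. -/
def radius (X : Set (Euc n)) : ℝ := 2 * sSup ((fun x : Euc n => ‖x‖) '' X)

/-- `K_x`: the supremum of `‖f(t,x,θ) - f(t,y,θ)‖ / ‖x - y‖` over `t ∈ S`, `θ ∈ Θ` and `x, y` in the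
closed ball of radius `a`, as an extended nonnegative real (the quotient is `0` for `x = y`). -/
def lipX (f : ℝ → Euc n → Euc p → Euc n) (S : Set ℝ) (Θ : Set (Euc p)) (a : ℝ) : ℝ≥0∞ :=
  ⨆ t ∈ S, ⨆ θ ∈ Θ, ⨆ x ∈ Metric.closedBall (0 : Euc n) a, ⨆ y ∈ Metric.closedBall (0 : Euc n) a,
    ‖f t x θ - f t y θ‖ₑ / ‖x - y‖ₑ

/-- `M`: the supremum of `‖f(t,x,θ)‖` over `t ∈ S`, `θ ∈ Θ` and `x` in the closed ball of
radius `a`, as an extended nonnegative real. -/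
def supF (f : ℝ → Euc n → Euc p → Euc n) (S : Set ℝ) (Θ : Set (Euc p)) (a : ℝ) : ℝ≥0∞ :=
  ⨆ t ∈ S, ⨆ θ ∈ Θ, ⨆ x ∈ Metric.closedBall (0 : Euc n) a, ‖f t x θ‖ₑ

/-- `h` is `C¹` on `S × ℝⁿ × Θ`. -/
def IsC1 (h : ℝ → Euc n → Euc p → Euc q) (S : Set ℝ) (Θ : Set (Euc p)) : Prop :=
  ContDiffOn ℝ 1 (fun z : ℝ × Euc n × Euc p => h z.1 z.2.1 z.2.2) (S ×ˢ univ ×ˢ Θ)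

/-- The partial derivatives of `h` in the state and in the parameter are Lipschitz continuous on
`S × ℝⁿ × Θ`. The parameter derivative is taken within `Θ`; if `Θ` has empty interior it is not
unique, and some Lipschitz choice of it is asked for. -/
def HasLipschitzPartials (h : ℝ → Euc n → Euc p → Euc q) (S : Set ℝ) (Θ : Set (Euc p)) : Prop :=
  ∃ (hx : ℝ × Euc n × Euc p → Euc n →L[ℝ] Euc q) (hθ : ℝ × Euc n × Euc p → Euc p →L[ℝ] Euc q)
    (K : ℝ≥0),
    LipschitzOnWith K hx (S ×ˢ univ ×ˢ Θ) ∧ LipschitzOnWith K hθ (S ×ˢ univ ×ˢ Θ) ∧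
    ∀ t ∈ S, ∀ x : Euc n, ∀ θ ∈ Θ,
      HasFDerivAt (fun x' => h t x' θ) (hx (t, x, θ)) x ∧
      HasFDerivWithinAt (fun θ' => h t x θ') (hθ (t, x, θ)) Θ θ

/-- The right-hand side `t ↦ x + ∫₀ᵗ f(s + t₀, u(s), θ) ds` of the Picard operator. -/
def picardFun (hT : 0 ≤ T) (f : ℝ → Euc n → Euc p → Euc n) (t₀ : ℝ) (x : Euc n) (θ : Euc p)
    (u : Traj T n) (t : Icc (0 : ℝ) T) : Euc n :=
  x + ∫ s in (0 : ℝ)..t, f (s + t₀) (IccExtend hT u s) θ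

open Classical in
/-- The Picard operator `P_{t₀,x,θ} : C[0,T] → C[0,T]`. The value `0` is a placeholder used only if
the formula fails to give a continuous function, which by `picard_apply` does not happen for
continuous `f`. -/
def picard (hT : 0 ≤ T) (f : ℝ → Euc n → Euc p → Euc n) (t₀ : ℝ) (x : Euc n) (θ : Euc p)
    (u : Traj T n) : Traj T n :=
  if h : Continuous (picardFun hT f t₀ x θ u) then ⟨picardFun hT f t₀ x θ u, h⟩ else 0

theorem picard_apply (hT : 0 ≤ T) (f : ℝ → Euc n → Euc p → Euc n) (t₀ : ℝ) (x : Euc n) (θ : Euc p)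
    (hf : ContinuousOn (fun z : ℝ × Euc n => f z.1 z.2 θ) (Icc t₀ (t₀ + T) ×ˢ univ))
    (u : Traj T n) (t : Icc (0 : ℝ) T) :
    picard hT f t₀ x θ u t = x + ∫ s in (0 : ℝ)..t, f (s + t₀) (IccExtend hT u s) θ := by
  have hu : Continuous (IccExtend hT u) := u.continuous.Icc_extend'
  have hc : ContinuousOn (fun s : ℝ => f (s + t₀) (IccExtend hT u s) θ) (Icc 0 T) := by
    refine hf.comp (f := fun s : ℝ => (s + t₀, IccExtend hT u s)) (by fun_prop) ?_
    intro s hs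
    exact ⟨⟨by linarith [hs.1], by linarith [hs.2]⟩, mem_univ _⟩
  have key : ∀ F : ℝ → Euc n, ContinuousOn F (Icc 0 T) →
      ContinuousOn (fun r : ℝ => ∫ s in (0 : ℝ)..r, F s) (Icc 0 T) := by
    intro F hF
    rw [← uIcc_of_le hT] at hF ⊢
    exact intervalIntegral.continuousOn_primitive_interval
      (hF.integrableOn_compact isCompact_uIcc)
  have hi := key _ hc
  have hcont : Continuous (picardFun hT f t₀ x θ u) :=
    continuous_const.add (continuousOn_iff_continuous_domRestrict.1 hi)
  rw [picard, dif_pos hcont]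
  rfl

/-- The metric projection `Π_K(z)`: a point of `K` nearest to `z`
(unique if `K` is nonempty, compact and convex). -/
def proj {d : ℕ} (K : Set (Euc d)) (z : Euc d) : Euc d :=
  Classical.epsilon fun w => w ∈ K ∧ IsMinOn (fun v => ‖v - z‖) K w

theorem proj_spec {d : ℕ} {K : Set (Euc d)} (hK : IsCompact K) (hne : K.Nonempty) (z : Euc d) :
    proj K z ∈ K ∧ IsMinOn (fun v => ‖v - z‖) K (proj K z) :=
  Classical.epsilon_spec (p := fun w => w ∈ K ∧ IsMinOn (fun v => ‖v - z‖) K w)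
    (hK.exists_isMinOn hne (by fun_prop))

/-- The index (counted from `0`) of the subinterval containing `t`: `j` with `jT ≤ t < (j+1)T`,
and the last one for `t = JT`. -/
def piece [NeZero J] (T t : ℝ) : Fin J :=
  ⟨min ⌊t / T⌋₊ (J - 1), by have := NeZero.pos J; omega⟩

/-- The extended loss `L_{λ,m}(x, θ, u)`. Subintervals, initial states and trajectories are indexed
by `Fin J`, so that the subinterval `j` starts at `jT`. For `t i ∈ [0, JT]` the local time
`t i - jT` lies in `[0, T]`. -/
def loss [NeZero J] (hT : 0 ≤ T) (f : ℝ → Euc n → Euc p → Euc n) (g : ℝ → Euc n → Euc p → Euc q)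
    (t : Fin N → ℝ) (y : Fin N → Euc q) (lam : ℝ) (m : ℕ)
    (x : Fin J → Euc n) (θ : Euc p) (u : Fin J → Traj T n) : ℝ :=
  let v : Fin J → Traj T n := fun j => (picard hT f ((j : ℝ) * T) (x j) θ)^[m] (u j)
  (∑ j : Fin (J - 1), lam *
      ‖v ⟨j, by have := j.isLt; omega⟩ ⟨T, hT, le_rfl⟩ - x ⟨j + 1, by have := j.isLt; omega⟩‖ ^ 2) +
  1 / (2 * (N : ℝ)) * ∑ i : Fin N,
      ‖y i - g (t i)
        (IccExtend hT (v (piece T (t i))) (t i - ((piece T (t i) : Fin J) : ℝ) * T)) θ‖ ^ 2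

/-- `(x, θ, u)`: initial states of the `J` subintervals, parameter, trajectories. -/
abbrev State (J n p : ℕ) (T : ℝ) : Type := (Fin J → Euc n) × Euc p × (Fin J → Traj T n)

/-- One iteration of the extended gradient-contract-multiplier algorithm. The gradient in `θ`
is taken within `Θ`. -/
def step [NeZero J] (hT : 0 ≤ T) (f : ℝ → Euc n → Euc p → Euc n) (g : ℝ → Euc n → Euc p → Euc q)
    (t : Fin N → ℝ) (y : Fin N → Euc q) (lam : ℝ) (X : Set (Euc n)) (Θ : Set (Euc p))
    (α σ : ℝ) (m : ℕ) (z : State J n p T) : State J n p T :=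
  let x := z.1
  let θ := z.2.1
  let u := z.2.2
  let x' : Fin J → Euc n := fun j =>
    proj X (x j - α • gradient (fun w => loss hT f g t y lam m (Function.update x j w) θ u) (x j))
  let θ' : Euc p :=
    proj Θ (θ - α • gradientWithin (fun w => loss hT f g t y lam m x w u) Θ θ)
  let u' : Fin J → Traj T n := fun j =>
    (1 - σ) • u j + σ • picard hT f ((j : ℝ) * T) (x' j) θ' (u j)
  (x', θ', u')

/-- The set `X^J × Θ × C_a^J`. -/
def domain (J : ℕ) (T : ℝ) (X : Set (Euc n)) (Θ : Set (Euc p)) (a : ℝ) : Set (State J n p T) :=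
  {z | (∀ j, z.1 j ∈ X) ∧ z.2.1 ∈ Θ ∧ ∀ j, ‖z.2.2 j‖ ≤ a}

/-- `L_{λ,m}` is strongly convex in `(x, θ)` on `X^J × Θ`, uniformly in `u ∈ C_a^J` and `m ≥ 1`. -/
def UniformlyStronglyConvexLoss [NeZero J] (hT : 0 ≤ T) (f : ℝ → Euc n → Euc p → Euc n)
    (g : ℝ → Euc n → Euc p → Euc q) (t : Fin N → ℝ) (y : Fin N → Euc q) (lam : ℝ)
    (X : Set (Euc n)) (Θ : Set (Euc p)) (a : ℝ) : Prop :=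
  ∃ μ : ℝ, 0 < μ ∧ ∀ m : ℕ, 1 ≤ m → ∀ u : Fin J → Traj T n, (∀ j, ‖u j‖ ≤ a) →
    ConvexOn ℝ ((univ.pi fun _ : Fin J => X) ×ˢ Θ)
      (fun w : (Fin J → Euc n) × Euc p =>
        loss hT f g t y lam m w.1 w.2 u - μ / 2 * ((∑ j, ‖w.1 j‖ ^ 2) + ‖w.2‖ ^ 2))

/-- The error `‖(x, θ) - (x', θ')‖₂ + ‖u - u'‖_∞`: Euclidean norm of the stacked vector `(x, θ)`,
and maximum over the subintervals of the supremum norm. -/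
def err (z z' : State J n p T) : ℝ :=
  Real.sqrt ((∑ j, ‖z.1 j - z'.1 j‖ ^ 2) + ‖z.2.1 - z'.2.1‖ ^ 2) + ‖z.2.2 - z'.2.2‖

end ParamEst

end

/-!
One iteration is a contraction, for the error distance, on the complete set `X^J × Θ × C_a^J`, so
the claim is Banach's fixed point theorem (`exists_fixedPoint_of_err_le`).

*Picard iterates.* As `T K_x < 1` and `2 T M < a`, each Picard operator with initial state in the
open ball of radius `a - T M`, which contains `X`, maps `C_a` into itself and contracts with the
factor `T K_x`. Its iterates and their derivatives in `(x, θ)` obey recursions that contract with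
this factor, so they are Lipschitz in `(x, θ)` with a constant independent of the order `m`, while
their dependence on the starting trajectory is `O(ρ ^ m)` for any `ρ` between `T K_x` and `1`
(`exists_smoothFamily_iterate_picard`). The loss inherits both properties (`unifSmooth_loss`).
Derivatives are handled through first-order expansions with quadratic remainder, the notion
`SmoothFamily`. It makes sense also when `Θ` has empty interior: derivatives in `θ` then are not
unique, but the projected step involves them only along differences of points of `Θ`, where they
are (`inner_gradientWithin_sub`).

*Gradient step.* The projections on `X` and `Θ` are equivalent to one variational inequality for the
stacked vector `(x, θ)` (`inner_step_le`). Uniform strong convexity makes the derivative of the loss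
strongly monotone, so for small `α` the step contracts `(x, θ)` by some `κ < 1`, up to a
perturbation `α c ρ ^ m ‖u - u'‖` from the trajectories (`norm_projected_step_sub_le`).

*Coupling.* The relaxed trajectory update contracts with the factor `1 - σ (1 - T K_x)`, up to `σ C`
times the change of `(x, θ)`. Choosing first `α`, then `σ` small, then `m` large makes the sum of
both errors contract (`exists_step_sizes`, `exists_step_contraction`).
-/

noncomputable section

namespace ParamEst

/-! ### Uniformly smooth families -/

section SmoothFamily

variable {E Z F : Type*} [NormedAddCommGroup E] [NormedSpace ℝ E] [SeminormedAddCommGroup Z]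
  [NormedAddCommGroup F] [NormedSpace ℝ F]

/-- The map `R : E → Z → F`, with `D w u` as its derivative in the first variable along `W`, is
smooth in a quantitative sense: on `W × U` both `R` and `D` are bounded by `c`, Lipschitz with
constant `c` in the first variable and `ε` in the second, and the first-order expansion of `R` in
the first variable has a remainder of at most `c ‖w' - w‖²`. The operator `D w u` need not be
determined by `R` if `W` is thin. -/
structure SmoothFamily (W : Set E) (U : Set Z) (R : E → Z → F) (D : E → Z → E →L[ℝ] F)
    (c ε : ℝ) : Prop where
  norm_le : ∀ w ∈ W, ∀ u ∈ U, ‖R w u‖ ≤ c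
  norm_deriv_le : ∀ w ∈ W, ∀ u ∈ U, ‖D w u‖ ≤ c
  lip : ∀ w ∈ W, ∀ w' ∈ W, ∀ u ∈ U, ∀ u' ∈ U,
    ‖R w' u' - R w u‖ ≤ c * ‖w' - w‖ + ε * ‖u' - u‖
  lip_deriv : ∀ w ∈ W, ∀ w' ∈ W, ∀ u ∈ U, ∀ u' ∈ U,
    ‖D w' u' - D w u‖ ≤ c * ‖w' - w‖ + ε * ‖u' - u‖
  remainder : ∀ w ∈ W, ∀ w' ∈ W, ∀ u ∈ U,
    ‖R w' u - R w u - D w u (w' - w)‖ ≤ c * ‖w' - w‖ ^ 2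

theorem SmoothFamily.mono {W : Set E} {U : Set Z} {R : E → Z → F} {D : E → Z → E →L[ℝ] F}
    {c ε c' ε' : ℝ} (h : SmoothFamily W U R D c ε) (hc : c ≤ c') (hε : ε ≤ ε') :
    SmoothFamily W U R D c' ε' where
  norm_le w hw u hu := (h.norm_le w hw u hu).trans hc
  norm_deriv_le w hw u hu := (h.norm_deriv_le w hw u hu).trans hc
  lip w hw w' hw' u hu u' hu' := (h.lip w hw w' hw' u hu u' hu').trans (by gcongr)
  lip_deriv w hw w' hw' u hu u' hu' := (h.lip_deriv w hw w' hw' u hu u' hu').trans (by gcongr)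
  remainder w hw w' hw' u hu := (h.remainder w hw w' hw' u hu).trans (by gcongr)

/-- A sequence of maps that are smooth with a common constant, and whose dependence on the second
variable (together with that of the derivative) decays like `ρ ^ m`. -/
def UnifSmooth (ρ : ℝ) (W : Set E) (U : Set Z) (R : ℕ → E → Z → F) : Prop :=
  ∃ c : ℝ, 0 ≤ c ∧ ∀ m, ∃ D : E → Z → E →L[ℝ] F, SmoothFamily W U (R m) D c (c * ρ ^ m)

variable {ρ : ℝ} {W : Set E} {U : Set Z}

theorem UnifSmooth.const (hρ : 0 ≤ ρ) (b : F) :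
    UnifSmooth ρ W U (fun (_ : ℕ) (_ : E) (_ : Z) => b) := by
  refine ⟨‖b‖, norm_nonneg b, fun m => ⟨fun _ _ => 0, ?_⟩⟩
  constructor <;> intros <;> simp <;> positivity

theorem UnifSmooth.clm (hρ : 0 ≤ ρ) (A : E →L[ℝ] F) {r : ℝ} (hr : ∀ w ∈ W, ‖A w‖ ≤ r) :
    UnifSmooth ρ W U (fun (_ : ℕ) (w : E) (_ : Z) => A w) := by
  have hc : 0 ≤ max r ‖A‖ := (norm_nonneg A).trans (le_max_right _ _)
  refine ⟨max r ‖A‖, hc, fun m => ⟨fun _ _ => A, ?_⟩⟩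
  have hm : 0 ≤ max r ‖A‖ * ρ ^ m := mul_nonneg hc (pow_nonneg hρ m)
  constructor
  · intro w hw u hu
    exact (hr w hw).trans (le_max_left _ _)
  · intros
    exact le_max_right _ _
  · intro w _ w' _ u _ u' _
    rw [← map_sub]
    refine (A.le_opNorm _).trans ?_
    have := mul_le_mul_of_nonneg_right (le_max_right r ‖A‖) (norm_nonneg (w' - w))
    have := mul_nonneg hm (norm_nonneg (u' - u))
    linarith
  · intro w _ w' _ u _ u' _
    rw [sub_self, norm_zero]
    positivity
  · intro w _ w' _ u _
    rw [map_sub, sub_self, norm_zero]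
    positivity

theorem UnifSmooth.add {R R' : ℕ → E → Z → F} (h : UnifSmooth ρ W U R)
    (h' : UnifSmooth ρ W U R') : UnifSmooth ρ W U (fun m w u => R m w u + R' m w u) := by
  obtain ⟨c, hc, h⟩ := h
  obtain ⟨c', hc', h'⟩ := h'
  refine ⟨c + c', add_nonneg hc hc', fun m => ?_⟩
  obtain ⟨D, h⟩ := h m
  obtain ⟨D', h'⟩ := h' m
  refine ⟨fun w u => D w u + D' w u, ?_⟩
  constructor
  · intro w hw u hu
    exact norm_add_le_of_le (h.norm_le w hw u hu) (h'.norm_le w hw u hu)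
  · intro w hw u hu
    exact norm_add_le_of_le (h.norm_deriv_le w hw u hu) (h'.norm_deriv_le w hw u hu)
  · intro w hw w' hw' u hu u' hu'
    rw [add_sub_add_comm]
    refine (norm_add_le_of_le (h.lip w hw w' hw' u hu u' hu')
      (h'.lip w hw w' hw' u hu u' hu')).trans (le_of_eq (by ring))
  · intro w hw w' hw' u hu u' hu'
    rw [add_sub_add_comm]
    refine (norm_add_le_of_le (h.lip_deriv w hw w' hw' u hu u' hu')
      (h'.lip_deriv w hw w' hw' u hu u' hu')).trans (le_of_eq (by ring))
  · intro w hw w' hw' u hu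
    rw [add_sub_add_comm, _root_.add_apply, add_sub_add_comm]
    refine (norm_add_le_of_le (h.remainder w hw w' hw' u hu)
      (h'.remainder w hw w' hw' u hu)).trans (le_of_eq (by ring))

theorem UnifSmooth.const_smul {R : ℕ → E → Z → F} (h : UnifSmooth ρ W U R) (b : ℝ) :
    UnifSmooth ρ W U (fun m w u => b • R m w u) := by
  obtain ⟨c, hc, h⟩ := h
  refine ⟨|b| * c, by positivity, fun m => ?_⟩
  obtain ⟨D, h⟩ := h m
  refine ⟨fun w u => b • D w u, ?_⟩
  constructor
  · intro w hw u hu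
    rw [norm_smul, Real.norm_eq_abs]
    exact mul_le_mul_of_nonneg_left (h.norm_le w hw u hu) (abs_nonneg b)
  · intro w hw u hu
    rw [norm_smul, Real.norm_eq_abs]
    exact mul_le_mul_of_nonneg_left (h.norm_deriv_le w hw u hu) (abs_nonneg b)
  · intro w hw w' hw' u hu u' hu'
    rw [← smul_sub, norm_smul, Real.norm_eq_abs]
    exact (mul_le_mul_of_nonneg_left (h.lip w hw w' hw' u hu u' hu') (abs_nonneg b)).trans
      (le_of_eq (by ring))
  · intro w hw w' hw' u hu u' hu'
    rw [← smul_sub, norm_smul, Real.norm_eq_abs]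
    exact (mul_le_mul_of_nonneg_left (h.lip_deriv w hw w' hw' u hu u' hu') (abs_nonneg b)).trans
      (le_of_eq (by ring))
  · intro w hw w' hw' u hu
    rw [← smul_sub, _root_.smul_apply, ← smul_sub, norm_smul, Real.norm_eq_abs]
    exact (mul_le_mul_of_nonneg_left (h.remainder w hw w' hw' u hu) (abs_nonneg b)).trans
      (le_of_eq (by ring))

theorem UnifSmooth.sub {R R' : ℕ → E → Z → F} (h : UnifSmooth ρ W U R)
    (h' : UnifSmooth ρ W U R') : UnifSmooth ρ W U (fun m w u => R m w u - R' m w u) := by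
  simpa [sub_eq_add_neg] using h.add (h'.const_smul (-1))

theorem UnifSmooth.sum {ι : Type*} (hρ : 0 ≤ ρ) (s : Finset ι) {R : ι → ℕ → E → Z → F}
    (h : ∀ i ∈ s, UnifSmooth ρ W U (R i)) :
    UnifSmooth ρ W U (fun m w u => ∑ i ∈ s, R i m w u) := by
  classical
  induction s using Finset.induction_on with
  | empty => simpa using UnifSmooth.const (E := E) (Z := Z) hρ (0 : F)
  | insert i s hi ih =>
    simp only [Finset.sum_insert hi]
    exact (h i (Finset.mem_insert_self i s)).add
      (ih fun k hk => h k (Finset.mem_insert_of_mem hk))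

theorem UnifSmooth.comp_right {Z' : Type*} [SeminormedAddCommGroup Z'] {U' : Set Z'}
    {R : ℕ → E → Z → F} (hρ : 0 ≤ ρ) (h : UnifSmooth ρ W U R) (φ : Z' → Z) (hφ : MapsTo φ U' U)
    (hlip : ∀ u u', ‖φ u' - φ u‖ ≤ ‖u' - u‖) :
    UnifSmooth ρ W U' (fun m w u => R m w (φ u)) := by
  obtain ⟨c, hc, h⟩ := h
  refine ⟨c, hc, fun m => ?_⟩
  obtain ⟨D, h⟩ := h m
  have hm : 0 ≤ c * ρ ^ m := by positivity
  refine ⟨fun w u => D w (φ u), ?_⟩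
  constructor
  · exact fun w hw u hu => h.norm_le w hw _ (hφ hu)
  · exact fun w hw u hu => h.norm_deriv_le w hw _ (hφ hu)
  · intro w hw w' hw' u hu u' hu'
    refine (h.lip w hw w' hw' _ (hφ hu) _ (hφ hu')).trans ?_
    gcongr
    exact hlip u u'
  · intro w hw w' hw' u hu u' hu'
    refine (h.lip_deriv w hw w' hw' _ (hφ hu) _ (hφ hu')).trans ?_
    gcongr
    exact hlip u u'
  · exact fun w hw w' hw' u hu => h.remainder w hw w' hw' _ (hφ hu)

end SmoothFamily

section NormSq

variable {E Z F : Type*} [NormedAddCommGroup E] [NormedSpace ℝ E] [SeminormedAddCommGroup Z]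
  [NormedAddCommGroup F] [InnerProductSpace ℝ F] {ρ : ℝ} {W : Set E} {U : Set Z}

theorem UnifSmooth.norm_sq {R : ℕ → E → Z → F} (h : UnifSmooth ρ W U R) :
    UnifSmooth ρ W U (fun m w u => ‖R m w u‖ ^ 2) := by
  obtain ⟨c, hc, h⟩ := h
  refine ⟨c ^ 2 * 4, by positivity, fun m => ?_⟩
  obtain ⟨D, h⟩ := h m
  refine ⟨fun w u => (2 : ℝ) • (innerSL ℝ (R m w u)).comp (D w u), ?_⟩
  constructor
  · intro w hw u hu
    have := h.norm_le w hw u hu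
    rw [Real.norm_of_nonneg (by positivity)]
    nlinarith [norm_nonneg (R m w u)]
  · intro w hw u hu
    rw [norm_smul, Real.norm_of_nonneg zero_le_two]
    have h1 := ContinuousLinearMap.opNorm_comp_le (innerSL ℝ (R m w u)) (D w u)
    rw [innerSL_apply_norm] at h1
    have h2 := mul_le_mul (h.norm_le w hw u hu) (h.norm_deriv_le w hw u hu) (norm_nonneg _) hc
    nlinarith
  · intro w hw w' hw' u hu u' hu'
    have h1 := h.lip w hw w' hw' u hu u' hu'
    have h2 := abs_norm_sub_norm_le (R m w' u') (R m w u)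
    have h3 : ‖R m w' u'‖ ^ 2 - ‖R m w u‖ ^ 2
        = (‖R m w' u'‖ - ‖R m w u‖) * (‖R m w' u'‖ + ‖R m w u‖) := by ring
    have h4 := h.norm_le w hw u hu
    have h5 := h.norm_le w' hw' u' hu'
    have h6 : |‖R m w' u'‖ + ‖R m w u‖| ≤ 2 * c := by
      rw [abs_of_nonneg (by positivity)]; linarith
    have h0 : 0 ≤ c * ‖w' - w‖ + c * ρ ^ m * ‖u' - u‖ := (norm_nonneg _).trans h1
    rw [Real.norm_eq_abs, h3, abs_mul]
    refine (mul_le_mul (h2.trans h1) h6 (abs_nonneg _) h0).trans ?_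
    nlinarith [mul_nonneg hc h0]
  · intro w hw w' hw' u hu u' hu'
    have h1 := h.lip w hw w' hw' u hu u' hu'
    have h1' := h.lip_deriv w hw w' hw' u hu u' hu'
    have h0 : 0 ≤ c * ‖w' - w‖ + c * ρ ^ m * ‖u' - u‖ := (norm_nonneg _).trans h1
    have h4 := h.norm_le w hw u hu
    have h5 := h.norm_deriv_le w' hw' u' hu'
    have h7 : (2 : ℝ) • (innerSL ℝ (R m w' u')).comp (D w' u')
          - (2 : ℝ) • (innerSL ℝ (R m w u)).comp (D w u)
        = (2 : ℝ) • ((innerSL ℝ (R m w' u' - R m w u)).comp (D w' u')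
          + (innerSL ℝ (R m w u)).comp (D w' u' - D w u)) := by
      rw [map_sub, ContinuousLinearMap.sub_comp, ContinuousLinearMap.comp_sub, ← smul_sub]
      congr 1
      abel
    have h8 := (ContinuousLinearMap.opNorm_comp_le (innerSL ℝ (R m w' u' - R m w u)) (D w' u'))
    have h9 := (ContinuousLinearMap.opNorm_comp_le (innerSL ℝ (R m w u)) (D w' u' - D w u))
    rw [innerSL_apply_norm] at h8 h9
    have h10 := mul_le_mul h1 h5 (norm_nonneg _) h0
    have h11 := mul_le_mul h4 h1' (norm_nonneg _) hc
    rw [h7, norm_smul, Real.norm_of_nonneg zero_le_two]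
    have := norm_add_le_of_le (h8.trans h10) (h9.trans h11)
    linarith
  · intro w hw w' hw' u hu
    have h1 : ‖R m w' u - R m w u‖ ≤ c * ‖w' - w‖ := by
      simpa using h.lip w hw w' hw' u hu u hu
    have h2 := h.remainder w hw w' hw' u hu
    have h3 : ‖R m w' u‖ ^ 2 - ‖R m w u‖ ^ 2
          - ((2 : ℝ) • (innerSL ℝ (R m w u)).comp (D w u)) (w' - w)
        = 2 * inner ℝ (R m w u) (R m w' u - R m w u - D w u (w' - w))
          + ‖R m w' u - R m w u‖ ^ 2 := by
      rw [norm_sub_sq_real, inner_sub_right, inner_sub_right, real_inner_self_eq_norm_sq,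
        real_inner_comm (R m w u)]
      simp
      ring
    rw [h3]
    have h4 := abs_real_inner_le_norm (R m w u) (R m w' u - R m w u - D w u (w' - w))
    have h5 := mul_le_mul (h.norm_le w hw u hu) h2 (norm_nonneg _) hc
    have h6 : ‖R m w' u - R m w u‖ ^ 2 ≤ (c * ‖w' - w‖) ^ 2 :=
      pow_le_pow_left₀ (norm_nonneg _) h1 2
    refine (norm_add_le _ _).trans ?_
    rw [norm_mul, Real.norm_of_nonneg zero_le_two, Real.norm_eq_abs,
      Real.norm_of_nonneg (by positivity)]
    nlinarith [mul_nonneg (sq_nonneg c) (sq_nonneg ‖w' - w‖)]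

end NormSq

/-! ### Quantitative smoothness in state and parameter -/

section StateParam

variable {n p q : ℕ}

/-- Quantitative smoothness of `h(x, θ)` on `B × Θ`, with partial derivatives `hx` and `hθ`. The
constant `k` bounds `hx` and is the Lipschitz constant in the state; the constant `c` serves for
every other estimate. The two are kept apart because the contraction property of the Picard
operator depends on `k` alone. -/
structure StateParamSmooth (B : Set (Euc n)) (Θ : Set (Euc p)) (h : Euc n → Euc p → Euc q)
    (hx : Euc n → Euc p → Euc n →L[ℝ] Euc q) (hθ : Euc n → Euc p → Euc p →L[ℝ] Euc q)
    (k c : ℝ) : Prop where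
  norm_le : ∀ x ∈ B, ∀ θ ∈ Θ, ‖h x θ‖ ≤ c
  norm_dx_le : ∀ x ∈ B, ∀ θ ∈ Θ, ‖hx x θ‖ ≤ k
  norm_dθ_le : ∀ x ∈ B, ∀ θ ∈ Θ, ‖hθ x θ‖ ≤ c
  lip : ∀ x ∈ B, ∀ x' ∈ B, ∀ θ ∈ Θ, ∀ θ' ∈ Θ,
    ‖h x' θ' - h x θ‖ ≤ k * ‖x' - x‖ + c * ‖θ' - θ‖
  lip_dx : ∀ x ∈ B, ∀ x' ∈ B, ∀ θ ∈ Θ, ∀ θ' ∈ Θ,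
    ‖hx x' θ' - hx x θ‖ ≤ c * (‖x' - x‖ + ‖θ' - θ‖)
  lip_dθ : ∀ x ∈ B, ∀ x' ∈ B, ∀ θ ∈ Θ, ∀ θ' ∈ Θ,
    ‖hθ x' θ' - hθ x θ‖ ≤ c * (‖x' - x‖ + ‖θ' - θ‖)
  remainder : ∀ x ∈ B, ∀ x' ∈ B, ∀ θ ∈ Θ, ∀ θ' ∈ Θ,
    ‖h x' θ' - h x θ - (hx x θ (x' - x) + hθ x θ (θ' - θ))‖ ≤ c * (‖x' - x‖ + ‖θ' - θ‖) ^ 2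

/-- Mean value inequality: a Lipschitz derivative gives a quadratic remainder. -/
theorem norm_sub_sub_le_of_lipschitz_deriv {E F : Type*} [NormedAddCommGroup E] [NormedSpace ℝ E]
    [NormedAddCommGroup F] [NormedSpace ℝ F] {s : Set E} (hs : Convex ℝ s) {φ : E → F}
    {φ' : E → E →L[ℝ] F} {K : ℝ} (hK : 0 ≤ K) (hφ : ∀ x ∈ s, HasFDerivWithinAt φ (φ' x) s x)
    (hlip : ∀ x ∈ s, ∀ y ∈ s, ‖φ' y - φ' x‖ ≤ K * ‖y - x‖) {x y : E} (hx : x ∈ s) (hy : y ∈ s) :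
    ‖φ y - φ x - φ' x (y - x)‖ ≤ K * ‖y - x‖ ^ 2 := by
  have hsub : s ∩ Metric.closedBall x ‖y - x‖ ⊆ s := inter_subset_left
  have := (hs.inter (convex_closedBall x ‖y - x‖)).norm_image_sub_le_of_norm_hasFDerivWithin_le'
    (f := φ) (f' := φ') (φ := φ' x) (C := K * ‖y - x‖) (x := x) (y := y)
    (fun z hz => (hφ z hz.1).mono hsub)
    (fun z hz => (hlip x hx z hz.1).trans (by
      have := mem_closedBall_iff_norm.1 hz.2
      gcongr))
    ⟨hx, Metric.mem_closedBall_self (norm_nonneg _)⟩ ⟨hy, mem_closedBall_iff_norm.2 le_rfl⟩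
  exact this.trans (le_of_eq (by ring))

/-- On a ball of states, Lipschitz partial derivatives make `h(t, ·, ·)` smooth in the quantitative
sense, with one constant for all times. -/
theorem exists_partials {S : Set ℝ} (hS : IsCompact S) {Θ : Set (Euc p)} (hΘ : IsCompact Θ)
    (hΘc : Convex ℝ Θ) {h : ℝ → Euc n → Euc p → Euc q} (hh : IsC1 h S Θ)
    (hh' : HasLipschitzPartials h S Θ) (a : ℝ) :
    ∃ (hx : ℝ × Euc n × Euc p → Euc n →L[ℝ] Euc q) (hθ : ℝ × Euc n × Euc p → Euc p →L[ℝ] Euc q)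
      (c : ℝ), 0 ≤ c ∧ ContinuousOn hx (S ×ˢ univ ×ˢ Θ) ∧ ContinuousOn hθ (S ×ˢ univ ×ˢ Θ) ∧
      (∀ t ∈ S, ∀ x : Euc n, ∀ θ ∈ Θ, HasFDerivAt (fun x' => h t x' θ) (hx (t, x, θ)) x) ∧
      ∀ t ∈ S, StateParamSmooth (Metric.closedBall 0 a) Θ (h t) (fun x θ => hx (t, x, θ))
        (fun x θ => hθ (t, x, θ)) c c := by
  obtain ⟨hx, hθ, K, hxL, hθL, hd⟩ := hh'
  have hcomp : IsCompact (S ×ˢ Metric.closedBall (0 : Euc n) a ×ˢ Θ) :=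
    hS.prod ((isCompact_closedBall 0 a).prod hΘ)
  have hsub : S ×ˢ Metric.closedBall (0 : Euc n) a ×ˢ Θ ⊆ S ×ˢ univ ×ˢ Θ :=
    prod_mono_right (prod_mono_left (subset_univ _))
  obtain ⟨c₀, hc₀⟩ := hcomp.exists_bound_of_continuousOn (hh.continuousOn.mono hsub)
  obtain ⟨c₁, hc₁⟩ := hcomp.exists_bound_of_continuousOn (hxL.continuousOn.mono hsub)
  obtain ⟨c₂, hc₂⟩ := hcomp.exists_bound_of_continuousOn (hθL.continuousOn.mono hsub)
  set c : ℝ := max (max c₀ c₁) (max c₂ K) with hc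
  have h0 : c₀ ≤ c := (le_max_left _ _).trans (le_max_left _ _)
  have h1 : c₁ ≤ c := (le_max_right _ _).trans (le_max_left _ _)
  have h2 : c₂ ≤ c := (le_max_left _ _).trans (le_max_right _ _)
  have hK : (K : ℝ) ≤ c := (le_max_right _ _).trans (le_max_right _ _)
  have hcn : 0 ≤ c := K.2.trans hK
  have hlip : ∀ {G : Type} [NormedAddCommGroup G] (φ : ℝ × Euc n × Euc p → G),
      LipschitzOnWith K φ (S ×ˢ univ ×ˢ Θ) → ∀ t ∈ S, ∀ x x' : Euc n, ∀ θ ∈ Θ, ∀ θ' ∈ Θ,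
      ‖φ (t, x', θ') - φ (t, x, θ)‖ ≤ c * (‖x' - x‖ + ‖θ' - θ‖) := by
    intro G _ φ hφ t ht x x' θ hθ θ' hθ'
    have := hφ.norm_sub_le (x := (t, x', θ')) (y := (t, x, θ)) ⟨ht, mem_univ _, hθ'⟩
      ⟨ht, mem_univ _, hθ⟩
    refine this.trans ?_
    have h3 : ‖(t, x', θ') - (t, x, θ)‖ ≤ ‖x' - x‖ + ‖θ' - θ‖ := by
      simp only [Prod.mk_sub_mk, sub_self, Prod.norm_mk, norm_zero]
      exact max_le (by positivity)
        (max_le (le_add_of_nonneg_right (norm_nonneg _)) (le_add_of_nonneg_left (norm_nonneg _)))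
    gcongr
  have hdxn : ∀ t ∈ S, ∀ x ∈ Metric.closedBall (0 : Euc n) a, ∀ θ ∈ Θ, ‖hx (t, x, θ)‖ ≤ c :=
    fun t ht x hxa θ hθ => (hc₁ (t, x, θ) ⟨ht, hxa, hθ⟩).trans h1
  have hdθn : ∀ t ∈ S, ∀ x ∈ Metric.closedBall (0 : Euc n) a, ∀ θ ∈ Θ, ‖hθ (t, x, θ)‖ ≤ c :=
    fun t ht x hxa θ hθ => (hc₂ (t, x, θ) ⟨ht, hxa, hθ⟩).trans h2
  refine ⟨hx, hθ, c, hcn, hxL.continuousOn, hθL.continuousOn,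
    fun t ht x θ hθ => (hd t ht x θ hθ).1, fun t ht => ?_⟩
  constructor
  · exact fun x hxa θ hθ => (hc₀ (t, x, θ) ⟨ht, hxa, hθ⟩).trans h0
  · exact hdxn t ht
  · exact hdθn t ht
  · intro x hxa x' hxa' θ hθm θ' hθm'
    have e1 := (convex_closedBall (0 : Euc n) a).norm_image_sub_le_of_norm_hasFDerivWithin_le
      (fun z _ => (hd t ht z θ' hθm').1.hasFDerivWithinAt)
      (fun z hz => hdxn t ht z hz θ' hθm') hxa hxa'
    have e2 := hΘc.norm_image_sub_le_of_norm_hasFDerivWithin_le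
      (fun z hz => (hd t ht x z hz).2) (fun z hz => hdθn t ht x hxa z hz) hθm hθm'
    rw [← sub_add_sub_cancel (h t x' θ') (h t x θ') (h t x θ)]
    exact norm_add_le_of_le e1 e2
  · exact fun x _ x' _ θ hθ θ' hθ' => hlip hx hxL t ht x x' θ hθ θ' hθ'
  · exact fun x _ x' _ θ hθm θ' hθm' => hlip hθ hθL t ht x x' θ hθm θ' hθm'
  · intro x hxa x' hxa' θ hθm θ' hθm'
    have e1 := norm_sub_sub_le_of_lipschitz_deriv (convex_univ (𝕜 := ℝ) (E := Euc n)) hcn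
      (φ' := fun z => hx (t, z, θ'))
      (fun z _ => (hd t ht z θ' hθm').1.hasFDerivWithinAt)
      (fun z _ z' _ => by simpa using hlip hx hxL t ht z z' θ' hθm' θ' hθm')
      (mem_univ x) (mem_univ x')
    have e2 := norm_sub_sub_le_of_lipschitz_deriv hΘc hcn
      (φ' := fun z => hθ (t, x, z)) (fun z hz => (hd t ht x z hz).2)
      (fun z hz z' hz' => by simpa using hlip hθ hθL t ht x x z hz z' hz') hθm hθm'
    have e3 : ‖hx (t, x, θ') - hx (t, x, θ)‖ ≤ c * ‖θ' - θ‖ := by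
      simpa using hlip hx hxL t ht x x θ hθm θ' hθm'
    have e4 : ‖(hx (t, x, θ') - hx (t, x, θ)) (x' - x)‖ ≤ c * ‖θ' - θ‖ * ‖x' - x‖ :=
      (ContinuousLinearMap.le_opNorm _ _).trans (by gcongr)
    have e5 : h t x' θ' - h t x θ - (hx (t, x, θ) (x' - x) + hθ (t, x, θ) (θ' - θ))
        = (h t x' θ' - h t x θ' - hx (t, x, θ') (x' - x))
          + (h t x θ' - h t x θ - hθ (t, x, θ) (θ' - θ))
          + (hx (t, x, θ') - hx (t, x, θ)) (x' - x) := by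
      rw [_root_.sub_apply]
      abel
    rw [e5]
    refine (norm_add_le_of_le (norm_add_le_of_le e1 e2) e4).trans ?_
    nlinarith [mul_nonneg (mul_nonneg hcn (norm_nonneg (θ' - θ))) (norm_nonneg (x' - x))]

variable {E Z : Type*} [NormedAddCommGroup E] [NormedSpace ℝ E] [SeminormedAddCommGroup Z]

/-- Chain rule for uniformly smooth families: the state enters through `V`, the parameter through
the linear map `A`. -/
theorem UnifSmooth.comp {ρ : ℝ} {W : Set E} {U : Set Z} {V : ℕ → E → Z → Euc n}
    (hρ : 0 ≤ ρ) (hV : UnifSmooth ρ W U V) {B : Set (Euc n)} {Θ : Set (Euc p)}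
    {h : Euc n → Euc p → Euc q} {hx : Euc n → Euc p → Euc n →L[ℝ] Euc q}
    {hθ : Euc n → Euc p → Euc p →L[ℝ] Euc q} {b : ℝ} (hb : 0 ≤ b)
    (hh : StateParamSmooth B Θ h hx hθ b b) (hVB : ∀ m, ∀ w ∈ W, ∀ u ∈ U, V m w u ∈ B)
    (A : E →L[ℝ] Euc p) (hA : ‖A‖ ≤ 1) (hAW : MapsTo A W Θ) :
    UnifSmooth ρ W U (fun m w u => h (V m w u) (A w)) := by
  obtain ⟨c, hc, hV⟩ := hV
  refine ⟨2 * b * (c + 1) ^ 2, by positivity, fun m => ?_⟩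
  obtain ⟨D, hV⟩ := hV m
  have hm : 0 ≤ ρ ^ m := pow_nonneg hρ m
  have hA' : ∀ w w', ‖A w' - A w‖ ≤ ‖w' - w‖ := fun w w' => by
    rw [← map_sub]
    exact (A.le_of_opNorm_le hA _).trans (by rw [one_mul])
  have hbc : 0 ≤ b * c := mul_nonneg hb hc
  have hbcc : 0 ≤ b * c ^ 2 := by positivity
  refine ⟨fun w u => (hx (V m w u) (A w)).comp (D w u) + (hθ (V m w u) (A w)).comp A, ?_⟩
  constructor
  · intro w hw u hu
    refine (hh.norm_le _ (hVB m w hw u hu) _ (hAW hw)).trans ?_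
    nlinarith
  · intro w hw u hu
    have hB := hVB m w hw u hu
    have h1 := (ContinuousLinearMap.opNorm_comp_le (hx (V m w u) (A w)) (D w u)).trans
      (mul_le_mul (hh.norm_dx_le _ hB _ (hAW hw)) (hV.norm_deriv_le w hw u hu) (norm_nonneg _) hb)
    have h2 := (ContinuousLinearMap.opNorm_comp_le (hθ (V m w u) (A w)) A).trans
      (mul_le_mul (hh.norm_dθ_le _ hB _ (hAW hw)) hA (norm_nonneg _) hb)
    refine (norm_add_le_of_le h1 h2).trans ?_
    nlinarith
  · intro w hw w' hw' u hu u' hu'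
    have h1 := hh.lip _ (hVB m w hw u hu) _ (hVB m w' hw' u' hu') _ (hAW hw) _ (hAW hw')
    have h2 := hV.lip w hw w' hw' u hu u' hu'
    have h3 := hA' w w'
    have h4 : b * ‖V m w' u' - V m w u‖ + b * ‖A w' - A w‖
        ≤ b * (c * ‖w' - w‖ + c * ρ ^ m * ‖u' - u‖) + b * ‖w' - w‖ := by gcongr
    refine (h1.trans h4).trans ?_
    have h5 : b * c + b ≤ 2 * b * (c + 1) ^ 2 := by nlinarith
    have h6 : b * c ≤ 2 * b * (c + 1) ^ 2 := by nlinarith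
    have h7 := mul_le_mul_of_nonneg_right h5 (norm_nonneg (w' - w))
    have h8 := mul_le_mul_of_nonneg_right h6 (mul_nonneg hm (norm_nonneg (u' - u)))
    linarith
  · intro w hw w' hw' u hu u' hu'
    have hB := hVB m w hw u hu
    have hB' := hVB m w' hw' u' hu'
    have h2 := hV.lip w hw w' hw' u hu u' hu'
    have h2' := hV.lip_deriv w hw w' hw' u hu u' hu'
    have h3 := hA' w w'
    set s : ℝ := c * ‖w' - w‖ + c * ρ ^ m * ‖u' - u‖ with hs
    have hs0 : 0 ≤ s := (norm_nonneg _).trans h2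
    have h4 : b * (‖V m w' u' - V m w u‖ + ‖A w' - A w‖) ≤ b * (s + ‖w' - w‖) := by gcongr
    have h4n : 0 ≤ b * (s + ‖w' - w‖) := by positivity
    have e1 := (hh.lip_dx _ hB _ hB' _ (hAW hw) _ (hAW hw')).trans h4
    have e2 := (hh.lip_dθ _ hB _ hB' _ (hAW hw) _ (hAW hw')).trans h4
    have e3 := (ContinuousLinearMap.opNorm_comp_le
      (hx (V m w' u') (A w') - hx (V m w u) (A w)) (D w' u')).trans
      (mul_le_mul e1 (hV.norm_deriv_le w' hw' u' hu') (norm_nonneg _) h4n)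
    have e4 := (ContinuousLinearMap.opNorm_comp_le (hx (V m w u) (A w)) (D w' u' - D w u)).trans
      (mul_le_mul (hh.norm_dx_le _ hB _ (hAW hw)) h2' (norm_nonneg _) hb)
    have e5 := (ContinuousLinearMap.opNorm_comp_le
      (hθ (V m w' u') (A w') - hθ (V m w u) (A w)) A).trans
      (mul_le_mul e2 hA (norm_nonneg _) h4n)
    have e6 : (hx (V m w' u') (A w')).comp (D w' u') + (hθ (V m w' u') (A w')).comp A
          - ((hx (V m w u) (A w)).comp (D w u) + (hθ (V m w u) (A w)).comp A)
        = (hx (V m w' u') (A w') - hx (V m w u) (A w)).comp (D w' u')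
          + (hx (V m w u) (A w)).comp (D w' u' - D w u)
          + (hθ (V m w' u') (A w') - hθ (V m w u) (A w)).comp A := by
      simp only [ContinuousLinearMap.sub_comp, ContinuousLinearMap.comp_sub]
      abel
    rw [e6]
    refine (norm_add_le_of_le (norm_add_le_of_le e3 e4) e5).trans ?_
    have h5 : b * (s + ‖w' - w‖) * c + b * s + b * (s + ‖w' - w‖) * 1
        ≤ b * (c + 2) * (s + ‖w' - w‖) := by nlinarith [mul_nonneg hb (norm_nonneg (w' - w))]
    refine h5.trans ?_
    have h6 : b * (c + 2) * (c + 1) ≤ 2 * b * (c + 1) ^ 2 := by nlinarith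
    have h7 : b * (c + 2) * c ≤ 2 * b * (c + 1) ^ 2 := by nlinarith
    have h8 := mul_le_mul_of_nonneg_right h6 (norm_nonneg (w' - w))
    have h9 := mul_le_mul_of_nonneg_right h7 (mul_nonneg hm (norm_nonneg (u' - u)))
    rw [hs]
    linarith
  · intro w hw w' hw' u hu
    have hB := hVB m w hw u hu
    have hB' := hVB m w' hw' u hu
    have h2 : ‖V m w' u - V m w u‖ ≤ c * ‖w' - w‖ := by simpa using hV.lip w hw w' hw' u hu u hu
    have h3 := hA' w w'
    have h4 : b * (‖V m w' u - V m w u‖ + ‖A w' - A w‖) ^ 2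
        ≤ b * (c * ‖w' - w‖ + ‖w' - w‖) ^ 2 := by gcongr
    have e1 := (hh.remainder _ hB _ hB' _ (hAW hw) _ (hAW hw')).trans h4
    have e2 := ((hx (V m w u) (A w)).le_opNorm (V m w' u - V m w u - D w u (w' - w))).trans
      (mul_le_mul (hh.norm_dx_le _ hB _ (hAW hw)) (hV.remainder w hw w' hw' u hu)
        (norm_nonneg _) hb)
    have e3 : h (V m w' u) (A w') - h (V m w u) (A w)
          - ((hx (V m w u) (A w)).comp (D w u) + (hθ (V m w u) (A w)).comp A) (w' - w)
        = (h (V m w' u) (A w') - h (V m w u) (A w)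
            - (hx (V m w u) (A w) (V m w' u - V m w u) + hθ (V m w u) (A w) (A w' - A w)))
          + hx (V m w u) (A w) (V m w' u - V m w u - D w u (w' - w)) := by
      rw [_root_.add_apply, ContinuousLinearMap.comp_apply, ContinuousLinearMap.comp_apply,
        map_sub (hx (V m w u) (A w)) (V m w' u - V m w u), map_sub A]
      abel
    rw [e3]
    refine (norm_add_le_of_le e1 e2).trans ?_
    have h6 : b * (c + 1) ^ 2 + b * c ≤ 2 * b * (c + 1) ^ 2 := by nlinarith
    have h8 := mul_le_mul_of_nonneg_right h6 (sq_nonneg ‖w' - w‖)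
    linarith

end StateParam

/-! ### Primitives of continuous functions on an interval -/

section Primitive

variable {T : ℝ} {F : Type*} [NormedAddCommGroup F] [NormedSpace ℝ F]

/-- The primitive `t ↦ ∫₀ᵗ Φ` of a continuous function on `[0, T]`. -/
def primitive (hT : 0 ≤ T) (Φ : C(Icc (0 : ℝ) T, F)) : C(Icc (0 : ℝ) T, F) where
  toFun t := ∫ s in (0 : ℝ)..t, IccExtend hT Φ s
  continuous_toFun :=
    (intervalIntegral.continuous_primitive
      (fun _ _ => (Φ.continuous.Icc_extend' (h := hT)).intervalIntegrable _ _) 0).comp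
      continuous_subtype_val

theorem primitive_apply (hT : 0 ≤ T) (Φ : C(Icc (0 : ℝ) T, F)) (t : Icc (0 : ℝ) T) :
    primitive hT Φ t = ∫ s in (0 : ℝ)..t, IccExtend hT Φ s := rfl

theorem primitive_sub (hT : 0 ≤ T) (Φ Ψ : C(Icc (0 : ℝ) T, F)) (t : Icc (0 : ℝ) T) :
    primitive hT (Φ - Ψ) t = primitive hT Φ t - primitive hT Ψ t :=
  intervalIntegral.integral_sub
    ((Φ.continuous.Icc_extend' (h := hT)).intervalIntegrable _ _)
    ((Ψ.continuous.Icc_extend' (h := hT)).intervalIntegrable _ _)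

theorem norm_primitive_le (hT : 0 ≤ T) {Φ : C(Icc (0 : ℝ) T, F)} {c : ℝ} (h : ∀ s, ‖Φ s‖ ≤ c)
    (t : Icc (0 : ℝ) T) : ‖primitive hT Φ t‖ ≤ T * c := by
  have hc : 0 ≤ c := (norm_nonneg _).trans (h t)
  have := intervalIntegral.norm_integral_le_of_norm_le_const (a := 0) (b := (t : ℝ)) (C := c)
    (f := IccExtend hT Φ) (fun s _ => h (projIcc 0 T hT s))
  rw [primitive_apply]
  refine this.trans ?_
  rw [sub_zero, abs_of_nonneg t.2.1, mul_comm]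
  exact mul_le_mul_of_nonneg_right t.2.2 hc

theorem norm_primitive_sub_le (hT : 0 ≤ T) {Φ Ψ : C(Icc (0 : ℝ) T, F)} {c : ℝ}
    (h : ∀ s, ‖Φ s - Ψ s‖ ≤ c) (t : Icc (0 : ℝ) T) :
    ‖primitive hT Φ t - primitive hT Ψ t‖ ≤ T * c := by
  rw [← primitive_sub]
  exact norm_primitive_le hT h t

theorem norm_primitive_sub_sub_apply_le {E : Type*} [NormedAddCommGroup E] [NormedSpace ℝ E]
    [CompleteSpace F]
    (hT : 0 ≤ T) {Φ Φ' : C(Icc (0 : ℝ) T, F)} {Ψ : C(Icc (0 : ℝ) T, E →L[ℝ] F)} {v : E} {c : ℝ}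
    (h : ∀ s, ‖Φ' s - Φ s - Ψ s v‖ ≤ c) (t : Icc (0 : ℝ) T) :
    ‖primitive hT Φ' t - primitive hT Φ t - primitive hT Ψ t v‖ ≤ T * c := by
  let Ψv : C(Icc (0 : ℝ) T, F) := ⟨fun s => Ψ s v, by fun_prop⟩
  have hv : primitive hT Ψ t v = primitive hT Ψv t :=
    ContinuousLinearMap.intervalIntegral_apply
      ((Ψ.continuous.Icc_extend' (h := hT)).intervalIntegrable _ _) v
  rw [hv, ← primitive_sub, ← primitive_sub]
  exact norm_primitive_le hT h t

end Primitive

/-! ### The Picard operator and its iterates -/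

section Picard

variable {n p : ℕ} {T : ℝ}

theorem norm_sub_le_lipX {f : ℝ → Euc n → Euc p → Euc n} {S : Set ℝ} {Θ : Set (Euc p)} {a : ℝ}
    (hK : lipX f S Θ a ≠ ⊤) {t : ℝ} (ht : t ∈ S) {θ : Euc p} (hθ : θ ∈ Θ) {x y : Euc n}
    (hx : x ∈ Metric.closedBall (0 : Euc n) a) (hy : y ∈ Metric.closedBall (0 : Euc n) a) :
    ‖f t x θ - f t y θ‖ ≤ (lipX f S Θ a).toReal * ‖x - y‖ := by
  rcases eq_or_ne x y with rfl | hxy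
  · simp
  have h1 : ‖f t x θ - f t y θ‖ₑ / ‖x - y‖ₑ ≤ lipX f S Θ a :=
    le_iSup₂_of_le t ht (le_iSup₂_of_le θ hθ (le_iSup₂_of_le x hx (le_iSup₂_of_le y hy le_rfl)))
  rw [ENNReal.div_le_iff (by simpa [sub_eq_zero] using hxy) enorm_ne_top] at h1
  have h2 := ENNReal.toReal_mono (ENNReal.mul_ne_top hK enorm_ne_top) h1
  simpa using h2

theorem norm_le_supF {f : ℝ → Euc n → Euc p → Euc n} {S : Set ℝ} {Θ : Set (Euc p)} {a : ℝ}
    (hM : supF f S Θ a ≠ ⊤) {t : ℝ} (ht : t ∈ S) {θ : Euc p} (hθ : θ ∈ Θ) {x : Euc n}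
    (hx : x ∈ Metric.closedBall (0 : Euc n) a) : ‖f t x θ‖ ≤ (supF f S Θ a).toReal := by
  have h1 : ‖f t x θ‖ₑ ≤ supF f S Θ a :=
    le_iSup₂_of_le t ht (le_iSup₂_of_le θ hθ (le_iSup₂_of_le x hx le_rfl))
  simpa using ENNReal.toReal_mono hM h1

/-- On the closed ball of radius `a` the state derivative is bounded by the Lipschitz constant: in
the open ball because `f` is Lipschitz near each point, on the sphere by continuity. -/
theorem norm_deriv_le_lipX {f : ℝ → Euc n → Euc p → Euc n} {S : Set ℝ} {Θ : Set (Euc p)} {a : ℝ}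
    (ha : 0 < a) (hK : lipX f S Θ a ≠ ⊤) {hx : ℝ × Euc n × Euc p → Euc n →L[ℝ] Euc n}
    (hxc : ContinuousOn hx (S ×ˢ univ ×ˢ Θ)) {t : ℝ} (ht : t ∈ S) {θ : Euc p} (hθ : θ ∈ Θ)
    (hd : ∀ x, HasFDerivAt (fun x' => f t x' θ) (hx (t, x, θ)) x) {x : Euc n}
    (hxa : x ∈ Metric.closedBall (0 : Euc n) a) :
    ‖hx (t, x, θ)‖ ≤ (lipX f S Θ a).toReal := by
  have hcont : Continuous fun x => hx (t, x, θ) := by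
    rw [← continuousOn_univ]
    exact hxc.comp (by fun_prop) fun x _ => ⟨ht, mem_univ _, hθ⟩
  have hclosed : IsClosed {x : Euc n | ‖hx (t, x, θ)‖ ≤ (lipX f S Θ a).toReal} :=
    isClosed_le hcont.norm continuous_const
  rw [← closure_ball (0 : Euc n) ha.ne'] at hxa
  refine hclosed.closure_subset_iff.2 (fun z hz => ?_) hxa
  refine (hd z).le_of_lip' ENNReal.toReal_nonneg ?_
  filter_upwards [Metric.isOpen_ball.mem_nhds hz] with z' hz'
  exact norm_sub_le_lipX hK ht hθ (Metric.ball_subset_closedBall hz')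
    (Metric.ball_subset_closedBall hz)

theorem picard_eq_primitive (hT : 0 ≤ T) {f : ℝ → Euc n → Euc p → Euc n} {t₀ : ℝ} {x : Euc n}
    {θ : Euc p} (hf : ContinuousOn (fun z : ℝ × Euc n => f z.1 z.2 θ) (Icc t₀ (t₀ + T) ×ˢ univ))
    {u : Traj T n} {Φ : C(Icc (0 : ℝ) T, Euc n)} (hΦ : ∀ s, Φ s = f (s + t₀) (u s) θ)
    (t : Icc (0 : ℝ) T) : picard hT f t₀ x θ u t = x + primitive hT Φ t := by
  rw [picard_apply hT f t₀ x θ hf, primitive_apply]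
  congr 1
  refine intervalIntegral.integral_congr fun s hs => ?_
  rw [uIcc_of_le t.2.1] at hs
  have hs' : s ∈ Icc (0 : ℝ) T := ⟨hs.1, hs.2.trans t.2.2⟩
  simp only [IccExtend_of_mem hT _ hs', hΦ]

variable {S : Set ℝ} {Θ : Set (Euc p)} {t₀ a k c : ℝ}
  {f : ℝ → Euc n → Euc p → Euc n} {hx : ℝ × Euc n × Euc p → Euc n →L[ℝ] Euc n}
  {hθ : ℝ × Euc n × Euc p → Euc p →L[ℝ] Euc n}

/-- Superposition with a trajectory preserves continuity. -/
theorem exists_continuousMap_comp {G : Type*} [NormedAddCommGroup G]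
    (hS : Icc t₀ (t₀ + T) ⊆ S) {φ : ℝ × Euc n × Euc p → G}
    (hφ : ContinuousOn φ (S ×ˢ univ ×ˢ Θ)) {θ : Euc p} (hθ' : θ ∈ Θ) (u : Traj T n) :
    ∃ Φ : C(Icc (0 : ℝ) T, G), ∀ s, Φ s = φ ((s : ℝ) + t₀, u s, θ) := by
  refine ⟨⟨fun s => φ ((s : ℝ) + t₀, u s, θ), ?_⟩, fun s => rfl⟩
  rw [← continuousOn_univ]
  refine hφ.comp (f := fun s : Icc (0 : ℝ) T => ((s : ℝ) + t₀, u s, θ))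
    (Continuous.continuousOn (by fun_prop)) fun s _ => ⟨hS ?_, mem_univ _, hθ'⟩
  exact ⟨by linarith [s.2.1], by linarith [s.2.2]⟩

theorem exists_primitive_picard (hT : 0 ≤ T) (hS : Icc t₀ (t₀ + T) ⊆ S)
    (hf : ContinuousOn (fun z : ℝ × Euc n × Euc p => f z.1 z.2.1 z.2.2) (S ×ˢ univ ×ˢ Θ))
    {θ : Euc p} (hθ' : θ ∈ Θ) (u : Traj T n) :
    ∃ Φ : C(Icc (0 : ℝ) T, Euc n), (∀ s, Φ s = f (s + t₀) (u s) θ) ∧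
      ∀ x t, picard hT f t₀ x θ u t = x + primitive hT Φ t := by
  obtain ⟨Φ, hΦ⟩ := exists_continuousMap_comp hS hf hθ' u
  refine ⟨Φ, hΦ, fun x t => picard_eq_primitive hT ?_ hΦ t⟩
  exact hf.comp (f := fun z : ℝ × Euc n => (z.1, z.2, θ)) (by fun_prop)
    fun z hz => ⟨hS hz.1, mem_univ _, hθ'⟩

theorem add_mem_of_Icc_subset (hS : Icc t₀ (t₀ + T) ⊆ S) (s : Icc (0 : ℝ) T) :
    (s : ℝ) + t₀ ∈ S :=
  hS ⟨by linarith [s.2.1], by linarith [s.2.2]⟩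

theorem apply_mem_closedBall {u : Traj T n} (hu : ‖u‖ ≤ a) (s : Icc (0 : ℝ) T) :
    u s ∈ Metric.closedBall (0 : Euc n) a :=
  mem_closedBall_zero_iff.2 ((u.norm_coe_le_norm s).trans hu)

theorem norm_picard_le (hT : 0 ≤ T) (hS : Icc t₀ (t₀ + T) ⊆ S)
    (hf : ContinuousOn (fun z : ℝ × Euc n × Euc p => f z.1 z.2.1 z.2.2) (S ×ˢ univ ×ˢ Θ))
    {M : ℝ} (hM : ∀ t ∈ S, ∀ x ∈ Metric.closedBall (0 : Euc n) a, ∀ θ ∈ Θ, ‖f t x θ‖ ≤ M)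
    {x : Euc n} (hxa : ‖x‖ + T * M ≤ a) {θ : Euc p} (hθ' : θ ∈ Θ) {u : Traj T n} (hu : ‖u‖ ≤ a) :
    ‖picard hT f t₀ x θ u‖ ≤ a := by
  obtain ⟨Φ, hΦ, hP⟩ := exists_primitive_picard hT hS hf hθ' u
  refine (ContinuousMap.norm_le _ ((norm_nonneg u).trans hu)).2 fun t => ?_
  rw [hP]
  refine (norm_add_le_of_le le_rfl (norm_primitive_le hT (c := M) (fun s => ?_) t)).trans hxa
  rw [hΦ]
  exact hM _ (add_mem_of_Icc_subset hS s) _ (apply_mem_closedBall hu s) _ hθ'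

/-- The Picard operator is Lipschitz in all its data, with constant `T k` in the trajectory. -/
theorem norm_picard_sub_le (hT : 0 ≤ T) (hS : Icc t₀ (t₀ + T) ⊆ S)
    (hf : ContinuousOn (fun z : ℝ × Euc n × Euc p => f z.1 z.2.1 z.2.2) (S ×ˢ univ ×ˢ Θ))
    (hk : 0 ≤ k)
    (hsm : ∀ t ∈ S, StateParamSmooth (Metric.closedBall 0 a) Θ (f t) (fun x θ => hx (t, x, θ))
      (fun x θ => hθ (t, x, θ)) k c)
    (x x' : Euc n) {θ θ' : Euc p} (hθ₁ : θ ∈ Θ) (hθ₂ : θ' ∈ Θ) {u u' : Traj T n}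
    (hu : ‖u‖ ≤ a) (hu' : ‖u'‖ ≤ a) :
    ‖picard hT f t₀ x' θ' u' - picard hT f t₀ x θ u‖
      ≤ ‖x' - x‖ + T * (k * ‖u' - u‖ + c * ‖θ' - θ‖) := by
  obtain ⟨Φ, hΦ, hP⟩ := exists_primitive_picard hT hS hf hθ₁ u
  obtain ⟨Φ', hΦ', hP'⟩ := exists_primitive_picard hT hS hf hθ₂ u'
  have key : ∀ s, ‖Φ' s - Φ s‖ ≤ k * ‖u' - u‖ + c * ‖θ' - θ‖ := fun s => by
    rw [hΦ, hΦ']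
    refine ((hsm _ (add_mem_of_Icc_subset hS s)).lip _ (apply_mem_closedBall hu s) _
      (apply_mem_closedBall hu' s) _ hθ₁ _ hθ₂).trans ?_
    have : ‖u' s - u s‖ ≤ ‖u' - u‖ := (u' - u).norm_coe_le_norm s
    gcongr
  have hpt : ∀ t, ‖(picard hT f t₀ x' θ' u' - picard hT f t₀ x θ u) t‖
      ≤ ‖x' - x‖ + T * (k * ‖u' - u‖ + c * ‖θ' - θ‖) := fun t => by
    rw [ContinuousMap.sub_apply, hP, hP', add_sub_add_comm]
    exact norm_add_le_of_le le_rfl (norm_primitive_sub_le hT key t)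
  exact (ContinuousMap.norm_le _ ((norm_nonneg _).trans (hpt ⟨0, le_rfl, hT⟩))).2 hpt

variable {E : Type*} [NormedAddCommGroup E] [NormedSpace ℝ E]

theorem norm_iterate_picard_le (hT : 0 ≤ T) {x : Euc n} {θ : Euc p}
    (hP : ∀ u, ‖u‖ ≤ a → ‖picard hT f t₀ x θ u‖ ≤ a) {u : Traj T n} (hu : ‖u‖ ≤ a) (m : ℕ) :
    ‖(picard hT f t₀ x θ)^[m] u‖ ≤ a := by
  induction m with
  | zero => exact hu
  | succ m ih =>
    rw [Function.iterate_succ_apply']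
    exact hP _ ih

/-- The iterates of the Picard operator depend smoothly on the data, with constants that do not grow
with the number of iterations, and the influence of the starting trajectory, on the iterate as well
as on its derivative, dies out geometrically. The derivatives solve the linearized recursion
`D_{m+1} = A + ∫ (∂ₓf D_m + ∂_θf A')`, which contracts with the same factor `T k < ρ`. -/
theorem exists_smoothFamily_iterate_picard (hT : 0 ≤ T) (hS : Icc t₀ (t₀ + T) ⊆ S)
    (hf : ContinuousOn (fun z : ℝ × Euc n × Euc p => f z.1 z.2.1 z.2.2) (S ×ˢ univ ×ˢ Θ))
    (hxc : ContinuousOn hx (S ×ˢ univ ×ˢ Θ)) (hθc : ContinuousOn hθ (S ×ˢ univ ×ˢ Θ))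
    (ha : 0 ≤ a) (hk : 0 ≤ k) (hc : 0 ≤ c)
    (hsm : ∀ t ∈ S, StateParamSmooth (Metric.closedBall 0 a) Θ (f t) (fun x θ => hx (t, x, θ))
      (fun x θ => hθ (t, x, θ)) k c)
    {ρ : ℝ} (hkρ : T * k < ρ) (hρ : ρ < 1) {W : Set E} (A : E →L[ℝ] Euc n) (hA : ‖A‖ ≤ 1)
    (A' : E →L[ℝ] Euc p) (hA' : ‖A'‖ ≤ 1) (hW : MapsTo A' W Θ)
    (hP : ∀ w ∈ W, ∀ u : Traj T n, ‖u‖ ≤ a → ‖picard hT f t₀ (A w) (A' w) u‖ ≤ a)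
    (t : Icc (0 : ℝ) T) :
    UnifSmooth ρ W {u : Traj T n | ‖u‖ ≤ a}
      (fun m w u => (picard hT f t₀ (A w) (A' w))^[m] u t) := by
  have hρ0 : 0 ≤ ρ := (mul_nonneg hT hk).trans hkρ.le
  set V : ℕ → E → Traj T n → Traj T n := fun m w u => (picard hT f t₀ (A w) (A' w))^[m] u with hV
  have hVa : ∀ m, ∀ w ∈ W, ∀ u : Traj T n, ‖u‖ ≤ a → ‖V m w u‖ ≤ a := fun m w hw u hu =>
    norm_iterate_picard_le hT (hP w hw) hu m
  have hVs : ∀ m w u, V (m + 1) w u = picard hT f t₀ (A w) (A' w) (V m w u) := fun m w u =>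
    Function.iterate_succ_apply' _ _ _
  have hAl : ∀ w w', ‖A w' - A w‖ ≤ ‖w' - w‖ := fun w w' => by
    rw [← map_sub]
    exact (A.le_of_opNorm_le hA _).trans (by rw [one_mul])
  have hAl' : ∀ w w', ‖A' w' - A' w‖ ≤ ‖w' - w‖ := fun w w' => by
    rw [← map_sub]
    exact (A'.le_of_opNorm_le hA' _).trans (by rw [one_mul])
  -- `cV` and `cD` are chosen so that the recursive estimates below reproduce themselves.
  set b : ℝ := T * c with hb
  have hb0 : 0 ≤ b := mul_nonneg hT hc
  set κ : ℝ := T * k with hκ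
  have hκ0 : 0 ≤ κ := mul_nonneg hT hk
  obtain ⟨cV, hcV0, hcV⟩ : ∃ cV : ℝ, 0 ≤ cV ∧ 1 + κ * cV + b ≤ cV := by
    refine ⟨(1 + b) / (1 - κ), div_nonneg (by linarith) (by linarith), ?_⟩
    have : (1 + b) / (1 - κ) * (1 - κ) = 1 + b := div_mul_cancel₀ _ (by linarith)
    linarith
  obtain ⟨cD, hcD0, hcD⟩ : ∃ cD : ℝ, 0 ≤ cD ∧ b * (1 + cV) ^ 2 ≤ cD * (ρ - κ) := by
    have h0 : 0 < ρ - κ := by linarith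
    refine ⟨b * (1 + cV) ^ 2 / (ρ - κ), by positivity, ?_⟩
    rw [div_mul_cancel₀ _ h0.ne']
  have hcD1 : κ * cD + b * (1 + cV) ^ 2 ≤ cD := by nlinarith
  have hcD2 : κ * cD + b * (1 + cV) ≤ cD * ρ := by nlinarith [mul_nonneg hb0 hcV0]
  have hVlip : ∀ m, ∀ w ∈ W, ∀ w' ∈ W, ∀ u u' : Traj T n, ‖u‖ ≤ a → ‖u'‖ ≤ a →
      ‖V m w' u' - V m w u‖ ≤ cV * ‖w' - w‖ + ρ ^ m * ‖u' - u‖ := by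
    intro m w hw w' hw' u u' hu hu'
    induction m with
    | zero =>
      simp only [hV, Function.iterate_zero, id, pow_zero, one_mul]
      exact le_add_of_nonneg_left (by positivity)
    | succ m ih =>
      rw [hVs, hVs]
      refine (norm_picard_sub_le hT hS hf hk hsm (A w) (A w') (hW hw) (hW hw')
        (hVa m w hw u hu) (hVa m w' hw' u' hu')).trans ?_
      have e1 : T * (k * ‖V m w' u' - V m w u‖ + c * ‖A' w' - A' w‖)
          ≤ T * (k * (cV * ‖w' - w‖ + ρ ^ m * ‖u' - u‖) + c * ‖w' - w‖) := by
        have := hAl' w w'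
        gcongr
      have e2 := hAl w w'
      have e3 := mul_le_mul_of_nonneg_right hcV (norm_nonneg (w' - w))
      have e4 := mul_le_mul_of_nonneg_right hkρ.le
        (mul_nonneg (pow_nonneg hρ0 m) (norm_nonneg (u' - u)))
      have e5 : T * (k * (cV * ‖w' - w‖ + ρ ^ m * ‖u' - u‖) + c * ‖w' - w‖)
          = κ * (cV * ‖w' - w‖) + κ * (ρ ^ m * ‖u' - u‖) + b * ‖w' - w‖ := by
        rw [hκ, hb]; ring
      rw [pow_succ]
      linarith
  have hD : ∀ m, ∃ D : E → Traj T n → C(Icc (0 : ℝ) T, E →L[ℝ] Euc n),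
      (∀ w ∈ W, ∀ u, ‖u‖ ≤ a → ∀ t, ‖D w u t‖ ≤ cV) ∧
      (∀ w ∈ W, ∀ w' ∈ W, ∀ u u', ‖u‖ ≤ a → ‖u'‖ ≤ a → ∀ t,
        ‖D w' u' t - D w u t‖ ≤ cD * ‖w' - w‖ + cD * ρ ^ m * ‖u' - u‖) ∧
      (∀ w ∈ W, ∀ w' ∈ W, ∀ u, ‖u‖ ≤ a → ∀ t,
        ‖V m w' u t - V m w u t - D w u t (w' - w)‖ ≤ cD * ‖w' - w‖ ^ 2) := by
    intro m
    induction m with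
    | zero =>
      refine ⟨fun _ _ => 0, ?_, ?_, ?_⟩
      · intros; simpa using hcV0
      · intro w _ w' _ u u' _ _ t
        simp only [sub_self, norm_zero]
        positivity
      · intro w _ w' _ u _ t
        simp only [hV, Function.iterate_zero, id, sub_self, ContinuousMap.zero_apply,
          _root_.zero_apply, norm_zero]
        positivity
    | succ m ih =>
      obtain ⟨D, hDn, hDl, hDr⟩ := ih
      have hΨex : ∀ w ∈ W, ∀ u : Traj T n, ∃ Ψ : C(Icc (0 : ℝ) T, E →L[ℝ] Euc n), ∀ s,
          Ψ s = (hx ((s : ℝ) + t₀, V m w u s, A' w)).comp (D w u s)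
            + (hθ ((s : ℝ) + t₀, V m w u s, A' w)).comp A' := by
        intro w hw u
        obtain ⟨Φ₁, h₁⟩ := exists_continuousMap_comp hS hxc (hW hw) (V m w u)
        obtain ⟨Φ₂, h₂⟩ := exists_continuousMap_comp hS hθc (hW hw) (V m w u)
        refine ⟨⟨fun s => (Φ₁ s).comp (D w u s) + (Φ₂ s).comp A', by fun_prop⟩, fun s => ?_⟩
        rw [← h₁, ← h₂]
        rfl
      choose! Ψ hΨ using hΨex
      refine ⟨fun w u => ContinuousMap.const _ A + primitive hT (Ψ w u), ?_, ?_, ?_⟩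
      · intro w hw u hu t
        have key : ∀ s, ‖Ψ w u s‖ ≤ k * cV + c * 1 := fun s => by
          have hs := hsm _ (add_mem_of_Icc_subset hS s)
          have hB := apply_mem_closedBall (hVa m w hw u hu) s
          rw [hΨ w hw]
          exact norm_add_le_of_le
            ((ContinuousLinearMap.opNorm_comp_le _ _).trans (mul_le_mul
              (hs.norm_dx_le _ hB _ (hW hw)) (hDn w hw u hu s) (norm_nonneg _) hk))
            ((ContinuousLinearMap.opNorm_comp_le _ _).trans (mul_le_mul
              (hs.norm_dθ_le _ hB _ (hW hw)) hA' (norm_nonneg _) hc))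
        refine (norm_add_le_of_le hA (norm_primitive_le hT key t)).trans ?_
        refine le_trans (le_of_eq ?_) hcV
        rw [hκ, hb]; ring
      · intro w hw w' hw' u u' hu hu' t
        have hv := hVlip m w hw w' hw' u u' hu hu'
        set σ : ℝ := cV * ‖w' - w‖ + ρ ^ m * ‖u' - u‖ with hσ
        have hσ0 : 0 ≤ σ := (norm_nonneg _).trans hv
        have key : ∀ s, ‖Ψ w' u' s - Ψ w u s‖
            ≤ c * (σ + ‖w' - w‖) * cV + k * (cD * ‖w' - w‖ + cD * ρ ^ m * ‖u' - u‖)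
              + c * (σ + ‖w' - w‖) * 1 := fun s => by
          have hs := hsm _ (add_mem_of_Icc_subset hS s)
          have hB := apply_mem_closedBall (hVa m w hw u hu) s
          have hB' := apply_mem_closedBall (hVa m w' hw' u' hu') s
          have h4 : c * (‖V m w' u' s - V m w u s‖ + ‖A' w' - A' w‖) ≤ c * (σ + ‖w' - w‖) := by
            have h5 := ((V m w' u' - V m w u).norm_coe_le_norm s).trans hv
            rw [ContinuousMap.sub_apply] at h5
            have := hAl' w w'
            gcongr
          have h4n : 0 ≤ c * (σ + ‖w' - w‖) := by positivity
          have e1 := (hs.lip_dx _ hB _ hB' _ (hW hw) _ (hW hw')).trans h4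
          have e2 := (hs.lip_dθ _ hB _ hB' _ (hW hw) _ (hW hw')).trans h4
          have e3 := (ContinuousLinearMap.opNorm_comp_le
            (hx ((s : ℝ) + t₀, V m w' u' s, A' w') - hx ((s : ℝ) + t₀, V m w u s, A' w))
            (D w' u' s)).trans (mul_le_mul e1 (hDn w' hw' u' hu' s) (norm_nonneg _) h4n)
          have e4 := (ContinuousLinearMap.opNorm_comp_le (hx ((s : ℝ) + t₀, V m w u s, A' w))
            (D w' u' s - D w u s)).trans
            (mul_le_mul (hs.norm_dx_le _ hB _ (hW hw)) (hDl w hw w' hw' u u' hu hu' s)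
              (norm_nonneg _) hk)
          have e5 := (ContinuousLinearMap.opNorm_comp_le
            (hθ ((s : ℝ) + t₀, V m w' u' s, A' w') - hθ ((s : ℝ) + t₀, V m w u s, A' w)) A').trans
            (mul_le_mul e2 hA' (norm_nonneg _) h4n)
          have e6 : Ψ w' u' s - Ψ w u s
              = (hx ((s : ℝ) + t₀, V m w' u' s, A' w')
                  - hx ((s : ℝ) + t₀, V m w u s, A' w)).comp (D w' u' s)
                + (hx ((s : ℝ) + t₀, V m w u s, A' w)).comp (D w' u' s - D w u s)
                + (hθ ((s : ℝ) + t₀, V m w' u' s, A' w')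
                  - hθ ((s : ℝ) + t₀, V m w u s, A' w)).comp A' := by
            rw [hΨ w hw, hΨ w' hw']
            simp only [ContinuousLinearMap.sub_comp, ContinuousLinearMap.comp_sub]
            abel
          rw [e6]
          exact norm_add_le_of_le (norm_add_le_of_le e3 e4) e5
        have e := norm_primitive_sub_le hT key t
        change ‖A + primitive hT (Ψ w' u') t - (A + primitive hT (Ψ w u) t)‖ ≤ _
        rw [add_sub_add_left_eq_sub]
        refine e.trans ?_
        have e7 := mul_le_mul_of_nonneg_right hcD1 (norm_nonneg (w' - w))
        have e8 := mul_le_mul_of_nonneg_right hcD2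
          (mul_nonneg (pow_nonneg hρ0 m) (norm_nonneg (u' - u)))
        have e9 : T * (c * (σ + ‖w' - w‖) * cV + k * (cD * ‖w' - w‖ + cD * ρ ^ m * ‖u' - u‖)
              + c * (σ + ‖w' - w‖) * 1)
            = (κ * cD + b * (1 + cV) ^ 2) * ‖w' - w‖
              + (κ * cD + b * (1 + cV)) * (ρ ^ m * ‖u' - u‖) := by
          rw [hκ, hb, hσ]; ring
        rw [e9, pow_succ ρ m]
        linarith
      · intro w hw w' hw' u hu t
        have hv : ‖V m w' u - V m w u‖ ≤ cV * ‖w' - w‖ := by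
          simpa using hVlip m w hw w' hw' u u hu hu
        obtain ⟨Φ, hΦ, hPΦ⟩ := exists_primitive_picard hT hS hf (hW hw) (V m w u)
        obtain ⟨Φ', hΦ', hPΦ'⟩ := exists_primitive_picard hT hS hf (hW hw') (V m w' u)
        have key : ∀ s, ‖Φ' s - Φ s - Ψ w u s (w' - w)‖
            ≤ c * (cV * ‖w' - w‖ + ‖w' - w‖) ^ 2 + k * (cD * ‖w' - w‖ ^ 2) := fun s => by
          have hs := hsm _ (add_mem_of_Icc_subset hS s)
          have hB := apply_mem_closedBall (hVa m w hw u hu) s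
          have hB' := apply_mem_closedBall (hVa m w' hw' u hu) s
          have h4 : c * (‖V m w' u s - V m w u s‖ + ‖A' w' - A' w‖) ^ 2
              ≤ c * (cV * ‖w' - w‖ + ‖w' - w‖) ^ 2 := by
            have h5 := ((V m w' u - V m w u).norm_coe_le_norm s).trans hv
            rw [ContinuousMap.sub_apply] at h5
            have := hAl' w w'
            gcongr
          have e1 := (hs.remainder _ hB _ hB' _ (hW hw) _ (hW hw')).trans h4
          have e2 := ((hx ((s : ℝ) + t₀, V m w u s, A' w)).le_opNorm
            (V m w' u s - V m w u s - D w u s (w' - w))).trans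
            (mul_le_mul (hs.norm_dx_le _ hB _ (hW hw)) (hDr w hw w' hw' u hu s)
              (norm_nonneg _) hk)
          have e3 : Φ' s - Φ s - Ψ w u s (w' - w)
              = (f (s + t₀) (V m w' u s) (A' w') - f (s + t₀) (V m w u s) (A' w)
                  - (hx ((s : ℝ) + t₀, V m w u s, A' w) (V m w' u s - V m w u s)
                    + hθ ((s : ℝ) + t₀, V m w u s, A' w) (A' w' - A' w)))
                + hx ((s : ℝ) + t₀, V m w u s, A' w)
                    (V m w' u s - V m w u s - D w u s (w' - w)) := by
            rw [hΨ w hw, hΦ, hΦ', _root_.add_apply, ContinuousLinearMap.comp_apply,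
              ContinuousLinearMap.comp_apply, map_sub _ (V m w' u s - V m w u s), map_sub A']
            abel
          rw [e3]
          exact norm_add_le_of_le e1 e2
        have e := norm_primitive_sub_sub_apply_le hT key t
        have e' : V (m + 1) w' u t - V (m + 1) w u t - (A + primitive hT (Ψ w u) t) (w' - w)
            = primitive hT Φ' t - primitive hT Φ t - primitive hT (Ψ w u) t (w' - w) := by
          rw [hVs, hVs, hPΦ, hPΦ', _root_.add_apply, map_sub A]
          abel
        change ‖V (m + 1) w' u t - V (m + 1) w u t - (A + primitive hT (Ψ w u) t) (w' - w)‖ ≤ _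
        rw [e']
        refine e.trans ?_
        have e7 := mul_le_mul_of_nonneg_right hcD1 (sq_nonneg ‖w' - w‖)
        refine le_trans (le_of_eq ?_) e7
        rw [hκ, hb]; ring
  set C : ℝ := a + cV + cD + 1 with hC
  refine ⟨C, by positivity, fun m => ?_⟩
  obtain ⟨D, hDn, hDl, hDr⟩ := hD m
  have hm : 0 ≤ ρ ^ m := pow_nonneg hρ0 m
  refine ⟨fun w u => D w u t, ?_⟩
  constructor
  · intro w hw u hu
    have := ((V m w u).norm_coe_le_norm t).trans (hVa m w hw u hu)
    linarith
  · intro w hw u hu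
    have := hDn w hw u hu t
    linarith
  · intro w hw w' hw' u hu u' hu'
    refine (((V m w' u' - V m w u).norm_coe_le_norm t).trans
      (hVlip m w hw w' hw' u u' hu hu')).trans ?_
    have h1 : cV ≤ C := by linarith
    have h2 : ρ ^ m ≤ C * ρ ^ m := le_mul_of_one_le_left hm (by linarith)
    gcongr
  · intro w hw w' hw' u hu u' hu'
    refine (hDl w hw w' hw' u u' hu hu' t).trans ?_
    have h1 : cD ≤ C := by linarith
    gcongr
  · intro w hw w' hw' u hu
    refine (hDr w hw w' hw' u hu t).trans ?_
    have h1 : cD ≤ C := by linarith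
    gcongr

end Picard

/-! ### The Euclidean space of initial states and parameters -/

section Data

variable {J n p : ℕ}

/-- Initial states of the `J` subintervals together with the parameter, with the Euclidean norm of
the stacked vector. -/
abbrev Data (J n p : ℕ) : Type := WithLp 2 (PiLp 2 (fun _ : Fin J => Euc n) × Euc p)

/-- The stacked vector with given initial states and parameter. -/
def mkData (x : Fin J → Euc n) (θ : Euc p) : Data J n p := WithLp.toLp 2 (WithLp.toLp 2 x, θ)

/-- The initial state of the subinterval `j`. -/
def stateL (j : Fin J) : Data J n p →L[ℝ] Euc n :=
  (PiLp.proj 2 (fun _ : Fin J => Euc n) j).comp (WithLp.fstL 2 ℝ _ _)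

/-- The parameter. -/
def paramL : Data J n p →L[ℝ] Euc p := WithLp.sndL 2 ℝ _ _

/-- The stacked vector all of whose components vanish except the initial state `j`. -/
def stateIncl (j : Fin J) : Euc n →L[ℝ] Data J n p :=
  (WithLp.prodContinuousLinearEquiv 2 ℝ _ _).symm.toContinuousLinearMap ∘L
    ContinuousLinearMap.inl ℝ _ _ ∘L
    (PiLp.continuousLinearEquiv 2 ℝ (fun _ : Fin J => Euc n)).symm.toContinuousLinearMap ∘L
    ContinuousLinearMap.single ℝ (fun _ : Fin J => Euc n) j

/-- The stacked vector with vanishing initial states. -/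
def paramIncl : Euc p →L[ℝ] Data J n p :=
  (WithLp.prodContinuousLinearEquiv 2 ℝ _ _).symm.toContinuousLinearMap ∘L
    ContinuousLinearMap.inr ℝ _ _

theorem stateIncl_apply (j : Fin J) (v : Euc n) :
    stateIncl (p := p) j v = mkData (Pi.single j v) 0 := rfl

theorem paramIncl_apply (v : Euc p) : paramIncl (J := J) (n := n) v = mkData 0 v := rfl

@[simp] theorem stateL_mkData (x : Fin J → Euc n) (θ : Euc p) (j : Fin J) :
    stateL j (mkData x θ) = x j := rfl

@[simp] theorem paramL_mkData (x : Fin J → Euc n) (θ : Euc p) :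
    paramL (mkData x θ) = θ := rfl

theorem mkData_sub (x x' : Fin J → Euc n) (θ θ' : Euc p) :
    mkData x θ - mkData x' θ' = mkData (x - x') (θ - θ') := rfl

theorem norm_sq_mkData (x : Fin J → Euc n) (θ : Euc p) :
    ‖mkData x θ‖ ^ 2 = (∑ j, ‖x j‖ ^ 2) + ‖θ‖ ^ 2 := by
  rw [WithLp.prod_norm_sq_eq_of_L2, PiLp.norm_sq_eq_of_L2]
  rfl

theorem inner_mkData (x x' : Fin J → Euc n) (θ θ' : Euc p) :
    inner ℝ (mkData x θ) (mkData x' θ') = (∑ j, inner ℝ (x j) (x' j)) + inner ℝ θ θ' := by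
  rw [WithLp.prod_inner_apply, PiLp.inner_apply]
  rfl

theorem norm_stateL_le (j : Fin J) : ‖stateL (n := n) (p := p) j‖ ≤ 1 :=
  ContinuousLinearMap.opNorm_le_bound _ zero_le_one fun w => by
    rw [one_mul]
    exact (PiLp.norm_apply_le w.fst j).trans (WithLp.norm_fst_le _ w)

theorem norm_paramL_le : ‖paramL (J := J) (n := n) (p := p)‖ ≤ 1 :=
  ContinuousLinearMap.opNorm_le_bound _ zero_le_one fun w => by
    rw [one_mul]
    exact WithLp.norm_snd_le _ w

theorem norm_stateIncl (j : Fin J) (v : Euc n) : ‖stateIncl (p := p) j v‖ = ‖v‖ := by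
  rw [stateIncl_apply, ← sq_eq_sq₀ (norm_nonneg _) (norm_nonneg _), norm_sq_mkData,
    Finset.sum_eq_single j (fun i _ hi => by simp [Pi.single_eq_of_ne hi]) (by simp)]
  simp

theorem norm_paramIncl (v : Euc p) : ‖paramIncl (J := J) (n := n) v‖ = ‖v‖ := by
  rw [paramIncl_apply, ← sq_eq_sq₀ (norm_nonneg _) (norm_nonneg _), norm_sq_mkData]
  simp

theorem mkData_eq_sum (x : Fin J → Euc n) (θ : Euc p) :
    mkData x θ = (∑ j, stateIncl j (x j)) + paramIncl θ := by
  have h1 : ∀ w w' : Data J n p, (∀ j, stateL j w = stateL j w') → paramL w = paramL w' →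
      w = w' := fun w w' h h' => WithLp.ofLp_injective 2
    (Prod.ext (PiLp.ext h) h')
  refine h1 _ _ (fun j => ?_) ?_
  · simp [stateIncl_apply, paramIncl_apply, Finset.sum_pi_single]
  · simp [stateIncl_apply, paramIncl_apply]

/-- The set of data with initial states in `X` and parameter in `Θ`. -/
def dataSet (J : ℕ) (X : Set (Euc n)) (Θ : Set (Euc p)) : Set (Data J n p) :=
  {w | (∀ j, stateL j w ∈ X) ∧ paramL w ∈ Θ}

end Data

/-! ### Smoothness of the loss -/

section Loss

variable {n p q N J : ℕ} {T : ℝ}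

/-- The loss inherits the uniform smoothness of the iterated Picard operators, being a sum of
squares of residuals. -/
theorem unifSmooth_loss [NeZero J] (hT : 0 ≤ T) {f : ℝ → Euc n → Euc p → Euc n}
    {g : ℝ → Euc n → Euc p → Euc q} {Γ : Set ℝ} {Θ : Set (Euc p)} {t : Fin N → ℝ}
    (ht : ∀ i, t i ∈ Γ) (y : Fin N → Euc q) (lam : ℝ) {ρ a b : ℝ} (hρ : 0 ≤ ρ) (hb : 0 ≤ b)
    {W : Set (Data J n p)} (hWa : ∀ w ∈ W, ∀ j, ‖stateL j w‖ ≤ a) (hWΘ : MapsTo paramL W Θ)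
    (hV : ∀ (j : Fin J) (s : Icc (0 : ℝ) T), UnifSmooth ρ W {u : Traj T n | ‖u‖ ≤ a}
      (fun m w u => (picard hT f ((j : ℝ) * T) (stateL j w) (paramL w))^[m] u s))
    (hVa : ∀ (j : Fin J) (m : ℕ), ∀ w ∈ W, ∀ u : Traj T n, ‖u‖ ≤ a →
      ‖(picard hT f ((j : ℝ) * T) (stateL j w) (paramL w))^[m] u‖ ≤ a)
    {gx : ℝ × Euc n × Euc p → Euc n →L[ℝ] Euc q} {gθ : ℝ × Euc n × Euc p → Euc p →L[ℝ] Euc q}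
    (hg : ∀ t ∈ Γ, StateParamSmooth (Metric.closedBall 0 a) Θ (g t) (fun x θ => gx (t, x, θ))
      (fun x θ => gθ (t, x, θ)) b b) :
    UnifSmooth ρ W {u : Fin J → Traj T n | ∀ j, ‖u j‖ ≤ a}
      (fun m w u => loss hT f g t y lam m (fun j => stateL j w) (paramL w) u) := by
  have hV' : ∀ (j : Fin J) (s : Icc (0 : ℝ) T),
      UnifSmooth ρ W {u : Fin J → Traj T n | ∀ j, ‖u j‖ ≤ a}
        (fun m w u => (picard hT f ((j : ℝ) * T) (stateL j w) (paramL w))^[m] (u j) s) :=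
    fun j s => (hV j s).comp_right hρ (fun u : Fin J → Traj T n => u j) (fun _ hu => hu j)
      (fun u u' => norm_le_pi_norm (u' - u) j)
  refine UnifSmooth.add (UnifSmooth.sum hρ _ fun j _ => ?_)
    (UnifSmooth.const_smul (UnifSmooth.sum hρ _ fun i _ => ?_) _)
  · exact (((hV' _ _).sub (UnifSmooth.clm hρ (stateL _) (r := a)
      fun w hw => hWa w hw _)).norm_sq).const_smul lam
  · refine ((UnifSmooth.const hρ (y i)).sub ?_).norm_sq
    exact UnifSmooth.comp hρ (hV' (piece T (t i)) (projIcc 0 T hT _)) hb (hg _ (ht i))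
      (fun m w hw u hu => apply_mem_closedBall (hVa _ m w hw _ (hu _)) _) paramL norm_paramL_le hWΘ

end Loss

/-! ### Projected gradient steps -/

section ProjectedGradient

theorem inner_sub_proj_le {d : ℕ} {K : Set (Euc d)} (hK : IsCompact K) (hKc : Convex ℝ K)
    (hne : K.Nonempty) (z : Euc d) {v : Euc d} (hv : v ∈ K) :
    inner ℝ (z - proj K z) (v - proj K z) ≤ 0 := by
  obtain ⟨hmem, hmin⟩ := proj_spec hK hne z
  refine (norm_eq_iInf_iff_real_inner_le_zero hKc hmem).1 ?_ v hv
  have : Nonempty K := hne.to_subtype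
  refine le_antisymm (le_ciInf fun w => ?_)
    (ciInf_le ⟨0, forall_mem_range.2 fun _ => norm_nonneg _⟩ (⟨_, hmem⟩ : K))
  rw [norm_sub_rev z, norm_sub_rev z]
  exact hmin w.2

variable {H : Type*} [NormedAddCommGroup H] [InnerProductSpace ℝ H]

/-- First-order lower bound for strongly convex functions, from a quadratic remainder only. -/
theorem le_sub_of_strongConvexOn {C : Set H} {φ : H → ℝ} {μ c : ℝ}
    (hφ : ConvexOn ℝ C fun w => φ w - μ / 2 * ‖w‖ ^ 2) {w w' : H} (hw : w ∈ C) (hw' : w' ∈ C)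
    {D : H →L[ℝ] ℝ} (hD : ∀ v ∈ C, ‖φ v - φ w - D (v - w)‖ ≤ c * ‖v - w‖ ^ 2) :
    D (w' - w) + μ / 2 * ‖w' - w‖ ^ 2 ≤ φ w' - φ w := by
  set d := w' - w with hd
  have key : ∀ s ∈ Ioo (0 : ℝ) 1,
      D d + μ / 2 * ‖d‖ ^ 2 - (c + μ / 2) * ‖d‖ ^ 2 * s ≤ φ w' - φ w := by
    intro s hs
    have hmem : (1 - s) • w + s • w' ∈ C :=
      hφ.1 hw hw' (by linarith [hs.2]) hs.1.le (by ring)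
    have h1 := hφ.2 hw hw' (by linarith [hs.2] : 0 ≤ 1 - s) hs.1.le (by ring)
    have e : (1 - s) • w + s • w' = w + s • d := by
      rw [hd, sub_smul, one_smul, smul_sub]; abel
    have h2 := hD _ hmem
    rw [e] at h1 h2
    rw [add_sub_cancel_left, norm_smul, map_smul, Real.norm_of_nonneg hs.1.le, smul_eq_mul,
      mul_pow] at h2
    have h3 := neg_le_of_abs_le h2
    have e1 : ‖w + s • d‖ ^ 2 = ‖w‖ ^ 2 + 2 * s * inner ℝ w d + s ^ 2 * ‖d‖ ^ 2 := by
      rw [norm_add_sq_real, real_inner_smul_right, norm_smul, mul_pow, Real.norm_of_nonneg hs.1.le]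
      ring
    have e2 : ‖w'‖ ^ 2 = ‖w‖ ^ 2 + 2 * inner ℝ w d + ‖d‖ ^ 2 := by
      rw [← norm_add_sq_real, hd, add_sub_cancel]
    simp only [smul_eq_mul] at h1
    rw [e1, e2] at h1
    have h4 : s * (D d + μ / 2 * ‖d‖ ^ 2 - (c + μ / 2) * ‖d‖ ^ 2 * s) ≤ s * (φ w' - φ w) := by
      linarith
    exact le_of_mul_le_mul_left h4 hs.1
  have hlim : Tendsto (fun s : ℝ => D d + μ / 2 * ‖d‖ ^ 2 - (c + μ / 2) * ‖d‖ ^ 2 * s)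
      (𝓝[>] 0) (𝓝 (D d + μ / 2 * ‖d‖ ^ 2 - (c + μ / 2) * ‖d‖ ^ 2 * 0)) :=
    (Continuous.tendsto (by fun_prop) 0).mono_left nhdsWithin_le_nhds
  rw [mul_zero, sub_zero] at hlim
  refine le_of_tendsto hlim ?_
  filter_upwards [Ioo_mem_nhdsGT one_pos] with s hs using key s hs

/-- The derivative of a strongly convex function is strongly monotone. -/
theorem strongly_monotone_of_strongConvexOn {C : Set H} {φ : H → ℝ} {μ c : ℝ}
    (hφ : ConvexOn ℝ C fun w => φ w - μ / 2 * ‖w‖ ^ 2) {D : H → H →L[ℝ] ℝ}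
    (hD : ∀ w ∈ C, ∀ v ∈ C, ‖φ v - φ w - D w (v - w)‖ ≤ c * ‖v - w‖ ^ 2)
    {w w' : H} (hw : w ∈ C) (hw' : w' ∈ C) :
    μ * ‖w' - w‖ ^ 2 ≤ (D w' - D w) (w' - w) := by
  have h1 := le_sub_of_strongConvexOn hφ hw hw' (hD w hw)
  have h2 := le_sub_of_strongConvexOn hφ hw' hw (hD w' hw')
  rw [norm_sub_rev w w', ← neg_sub w' w, map_neg] at h2
  rw [_root_.sub_apply]
  linarith

/-- Two projected gradient steps, given through their variational inequalities. The derivatives are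
`D` at `w` and `D'` at `w'`; the intermediate `D₀` is the derivative at `w` of the function whose
derivative at `w'` is `D'`. Comparing `D'` with `D₀` gives the contraction factor `κ`, comparing
`D₀` with `D` the perturbation. -/
theorem norm_projected_step_sub_le [CompleteSpace H] {w w' v v' : H} {D D' D₀ : H →L[ℝ] ℝ}
    {α μ c κ δ : ℝ}
    (hα : 0 ≤ α) (hκ : 0 ≤ κ) (hκα : 1 - 2 * α * μ + α ^ 2 * c ^ 2 ≤ κ ^ 2)
    (hv : inner ℝ (w - v) (v' - v) ≤ α * D (v' - v))
    (hv' : inner ℝ (w' - v') (v - v') ≤ α * D' (v - v'))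
    (hmono : μ * ‖w' - w‖ ^ 2 ≤ (D' - D₀) (w' - w)) (hlip : ‖D' - D₀‖ ≤ c * ‖w' - w‖)
    (hδ : ‖D₀ - D‖ ≤ δ) :
    ‖v' - v‖ ≤ κ * ‖w' - w‖ + α * δ := by
  set r : H := (InnerProductSpace.toDual ℝ H).symm (D' - D₀) with hr
  have hri : ∀ z, inner ℝ r z = (D' - D₀) z := fun z =>
    InnerProductSpace.toDual_symm_apply
  have hrn : ‖r‖ ≤ c * ‖w' - w‖ := by rw [hr, LinearIsometryEquiv.norm_map]; exact hlip
  have h1 : ‖(w' - w) - α • r‖ ≤ κ * ‖w' - w‖ := by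
    refine le_of_sq_le_sq ?_ (by positivity)
    rw [norm_sub_sq_real, real_inner_smul_right, norm_smul, Real.norm_of_nonneg hα,
      real_inner_comm, hri]
    have h2 := mul_le_mul_of_nonneg_left hmono hα
    have h3 : (α * ‖r‖) ^ 2 ≤ α ^ 2 * (c * ‖w' - w‖) ^ 2 := by
      rw [mul_pow]; gcongr
    have h4 := mul_le_mul_of_nonneg_right hκα (sq_nonneg ‖w' - w‖)
    nlinarith
  have h2 : ‖v' - v‖ ^ 2 ≤ inner ℝ ((w' - w) - α • r) (v' - v) - α * (D₀ - D) (v' - v) := by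
    have e1 : inner ℝ (w' - v') (v - v') = - inner ℝ (w' - v') (v' - v) := by
      rw [← inner_neg_right, neg_sub]
    have e2 : D' (v - v') = - D' (v' - v) := by rw [← map_neg, neg_sub]
    have e3 : (w' - w) - α • r = (w' - v') - (w - v) + (v' - v) - α • r := by abel
    rw [e1, e2] at hv'
    rw [e3, inner_sub_left, inner_add_left, inner_sub_left, real_inner_smul_left, hri,
      real_inner_self_eq_norm_sq, _root_.sub_apply, _root_.sub_apply]
    linarith
  have h3 := real_inner_le_norm ((w' - w) - α • r) (v' - v)
  have h4 : |(D₀ - D) (v' - v)| ≤ δ * ‖v' - v‖ := (D₀ - D).le_of_opNorm_le hδ _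
  have h5 := mul_le_mul_of_nonneg_left (neg_le_of_abs_le h4) hα
  have h6 := mul_le_mul_of_nonneg_right h1 (norm_nonneg (v' - v))
  have h7 : ‖v' - v‖ * ‖v' - v‖ ≤ (κ * ‖w' - w‖ + α * δ) * ‖v' - v‖ := by nlinarith
  rcases (norm_nonneg (v' - v)).eq_or_lt with h0 | h0
  · rw [← h0]
    have := (norm_nonneg _).trans hδ
    positivity
  · exact le_of_mul_le_mul_right h7 h0

/-- A quadratic remainder bound gives differentiability within a set. -/
theorem hasFDerivWithinAt_of_remainder {G F : Type*} [NormedAddCommGroup G] [NormedSpace ℝ G]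
    [NormedAddCommGroup F] [NormedSpace ℝ F] {φ : G → F} {φ' : G →L[ℝ] F} {s : Set G} {x : G}
    {c : ℝ} (h : ∀ᶠ z in 𝓝[s] x, ‖φ z - φ x - φ' (z - x)‖ ≤ c * ‖z - x‖ ^ 2) :
    HasFDerivWithinAt φ φ' s x := by
  rw [hasFDerivWithinAt_iff_isLittleO]
  have h1 : (fun z => φ z - φ x - φ' (z - x)) =O[𝓝[s] x] fun z => ‖z - x‖ ^ 2 :=
    Asymptotics.IsBigO.of_bound c (by simpa using h)
  exact h1.trans_isLittleO
    ((Asymptotics.isLittleO_pow_sub_sub x one_lt_two).mono nhdsWithin_le_nhds)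

/-- The gradient within a convex set is determined in the directions pointing into the set, even if
the set has empty interior. -/
theorem inner_gradientWithin_sub {d : ℕ} {K : Set (Euc d)} (hK : Convex ℝ K) {φ : Euc d → ℝ}
    {φ' : Euc d →L[ℝ] ℝ} {x z : Euc d} (hx : x ∈ K) (hz : z ∈ K)
    (h : HasFDerivWithinAt φ φ' K x) : inner ℝ (gradientWithin φ K x) (z - x) = φ' (z - x) := by
  rw [inner_gradientWithin_left]
  exact h.differentiableWithinAt.hasFDerivWithinAt.unique_on h
    (mem_tangentConeAt_of_segment_subset (hK.segment_subset hx hz))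

end ProjectedGradient

/-! ### The gradient step of the algorithm -/

section GradientStep

variable {n p q N J : ℕ} {T : ℝ}

/-- The gradient step is characterized by a variational inequality for the derivative of the
loss in all initial states and the parameter jointly. `W` contains a neighbourhood of `X` in each
initial state, which makes the gradients in the initial states genuine. -/
theorem inner_step_le [NeZero J] (hT : 0 ≤ T) {f : ℝ → Euc n → Euc p → Euc n}
    {g : ℝ → Euc n → Euc p → Euc q} {t : Fin N → ℝ} {y : Fin N → Euc q} {lam : ℝ}
    {X B : Set (Euc n)} {Θ : Set (Euc p)} {a c ε : ℝ} {m : ℕ}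
    (hX : IsCompact X) (hXc : Convex ℝ X) (hXne : X.Nonempty)
    (hΘ : IsCompact Θ) (hΘc : Convex ℝ Θ) (hΘne : Θ.Nonempty)
    (hB : IsOpen B) (hXB : X ⊆ B)
    {D : Data J n p → (Fin J → Traj T n) → Data J n p →L[ℝ] ℝ}
    (hD : SmoothFamily (dataSet J B Θ) {u : Fin J → Traj T n | ∀ j, ‖u j‖ ≤ a}
      (fun w u => loss hT f g t y lam m (fun j => stateL j w) (paramL w) u) D c ε)
    (α σ : ℝ) {z : State J n p T} (hz : z ∈ domain J T X Θ a)
    {v : Data J n p} (hv : v ∈ dataSet J X Θ) :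
    inner ℝ (mkData z.1 z.2.1
        - mkData (step hT f g t y lam X Θ α σ m z).1 (step hT f g t y lam X Θ α σ m z).2.1)
      (v - mkData (step hT f g t y lam X Θ α σ m z).1 (step hT f g t y lam X Θ α σ m z).2.1)
      ≤ α * D (mkData z.1 z.2.1) z.2.2
        (v - mkData (step hT f g t y lam X Θ α σ m z).1
          (step hT f g t y lam X Θ α σ m z).2.1) := by
  obtain ⟨x, θ, u⟩ := z
  obtain ⟨hx, hθ, hu⟩ := hz
  dsimp only at hx hθ hu
  set Dz := D (mkData x θ) u with hDz
  have hwB : mkData x θ ∈ dataSet J B Θ := ⟨fun j => hXB (hx j), hθ⟩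
  set z' := step hT f g t y lam X Θ α σ m (x, θ, u) with hz'
  have hxd : ∀ j, HasFDerivAt (fun w => loss hT f g t y lam m (Function.update x j w) θ u)
      (Dz.comp (stateIncl j)) (x j) := by
    intro j
    rw [← hasFDerivWithinAt_univ]
    refine hasFDerivWithinAt_of_remainder (c := c) ?_
    rw [nhdsWithin_univ]
    filter_upwards [hB.mem_nhds (hXB (hx j))] with w hw
    have hmem : mkData (Function.update x j w) θ ∈ dataSet J B Θ := by
      refine ⟨fun i => ?_, hθ⟩
      rcases eq_or_ne i j with rfl | hij
      · simpa using hw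
      · simpa [hij] using hXB (hx i)
    have e : mkData (Function.update x j w) θ - mkData x θ = stateIncl j (w - x j) := by
      rw [mkData_sub, sub_self, stateIncl_apply]
      congr 1
      ext1 i
      rcases eq_or_ne i j with rfl | hij
      · simp
      · simp [hij]
    have h1 := hD.remainder _ hwB _ hmem u hu
    rw [e, norm_stateIncl] at h1
    rw [Function.update_eq_self]
    exact h1
  have hθd : HasFDerivWithinAt (fun w => loss hT f g t y lam m x w u)
      (Dz.comp paramIncl) Θ θ := by
    refine hasFDerivWithinAt_of_remainder (c := c) ?_
    filter_upwards [self_mem_nhdsWithin] with w hw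
    have hmem : mkData x w ∈ dataSet J B Θ := ⟨fun i => hXB (hx i), hw⟩
    have e : mkData x w - mkData x θ = paramIncl (w - θ) := by
      rw [mkData_sub, sub_self, paramIncl_apply]
    have h1 := hD.remainder _ hwB _ hmem u hu
    rw [e, norm_paramIncl] at h1
    exact h1
  have hθ' : z'.2.1 ∈ Θ := (proj_spec hΘ hΘne _).1
  have hxi : ∀ j, inner ℝ (x j - z'.1 j) (stateL j v - z'.1 j)
      ≤ α * Dz (stateIncl j (stateL j v - z'.1 j)) := by
    intro j
    have h1 := inner_sub_proj_le hX hXc hXne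
      (x j - α • gradient (fun w => loss hT f g t y lam m (Function.update x j w) θ u) (x j))
      (hv.1 j)
    change inner ℝ (_ - z'.1 j) (stateL j v - z'.1 j) ≤ 0 at h1
    rw [sub_right_comm, inner_sub_left, real_inner_smul_left, inner_gradient_left,
      (hxd j).fderiv] at h1
    exact sub_nonpos.1 h1
  have hθi : inner ℝ (θ - z'.2.1) (paramL v - z'.2.1)
      ≤ α * Dz (paramIncl (paramL v - z'.2.1)) := by
    have h1 := inner_sub_proj_le hΘ hΘc hΘne
      (θ - α • gradientWithin (fun w => loss hT f g t y lam m x w u) Θ θ) hv.2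
    change inner ℝ (_ - z'.2.1) (paramL v - z'.2.1) ≤ 0 at h1
    -- Both points lie in `Θ`, so their difference is a difference of admissible directions.
    have e : paramL v - z'.2.1 = (paramL v - θ) - (z'.2.1 - θ) := by abel
    have h2 : inner ℝ (gradientWithin (fun w => loss hT f g t y lam m x w u) Θ θ)
        (paramL v - z'.2.1) = Dz (paramIncl (paramL v - z'.2.1)) := by
      rw [e, inner_sub_right, inner_gradientWithin_sub hΘc hθ hv.2 hθd,
        inner_gradientWithin_sub hΘc hθ hθ' hθd, ← map_sub]
      rfl
    rw [sub_right_comm, inner_sub_left, real_inner_smul_left, h2] at h1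
    exact sub_nonpos.1 h1
  have e1 : v - mkData z'.1 z'.2.1
      = mkData (fun j => stateL j v - z'.1 j) (paramL v - z'.2.1) := rfl
  have e2 : mkData x θ - mkData z'.1 z'.2.1
      = mkData (fun j => x j - z'.1 j) (θ - z'.2.1) := rfl
  rw [e1, e2, inner_mkData, mkData_eq_sum, map_add, map_sum, mul_add, Finset.mul_sum]
  exact add_le_add (Finset.sum_le_sum fun j _ => hxi j) hθi

end GradientStep

/-! ### Contractions in the error -/

section Err

variable {n p J : ℕ} {T : ℝ}

theorem err_eq (z z' : State J n p T) :
    err z z' = ‖mkData z.1 z.2.1 - mkData z'.1 z'.2.1‖ + ‖z.2.2 - z'.2.2‖ := by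
  rw [err, mkData_sub, ← Real.sqrt_sq (norm_nonneg (mkData (z.1 - z'.1) (z.2.1 - z'.2.1))),
    norm_sq_mkData]
  rfl

theorem dist_le_err (z z' : State J n p T) : dist z z' ≤ err z z' := by
  have h0 := norm_nonneg (mkData z.1 z.2.1 - mkData z'.1 z'.2.1)
  have h1 := norm_nonneg (z.2.2 - z'.2.2)
  rw [err_eq, Prod.dist_eq, Prod.dist_eq]
  refine max_le ((dist_pi_le_iff (by positivity)).2 fun j => ?_) (max_le ?_ ?_)
  · have := (stateL j).le_of_opNorm_le (norm_stateL_le j)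
      (mkData z.1 z.2.1 - mkData z'.1 z'.2.1)
    rw [map_sub, stateL_mkData, stateL_mkData, one_mul] at this
    rw [dist_eq_norm]
    linarith
  · have := paramL.le_of_opNorm_le norm_paramL_le (mkData z.1 z.2.1 - mkData z'.1 z'.2.1)
    rw [map_sub, paramL_mkData, paramL_mkData, one_mul] at this
    rw [dist_eq_norm]
    linarith
  · rw [dist_eq_norm]
    linarith

theorem continuous_err_left (z' : State J n p T) : Continuous fun z => err z z' := by
  unfold err
  fun_prop

theorem err_self (z : State J n p T) : err z z = 0 := by simp [err_eq]

theorem isClosed_domain {X : Set (Euc n)} {Θ : Set (Euc p)} (hX : IsClosed X) (hΘ : IsClosed Θ)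
    (a : ℝ) : IsClosed (domain J T X Θ a) := by
  have e : domain J T X Θ a = (⋂ j, {z | z.1 j ∈ X}) ∩ ({z | z.2.1 ∈ Θ} ∩
      ⋂ j, {z | ‖z.2.2 j‖ ≤ a}) := by
    ext z; simp [domain]
  rw [e]
  refine (isClosed_iInter fun j => hX.preimage (by fun_prop)).inter
    ((hΘ.preimage (by fun_prop)).inter (isClosed_iInter fun j => ?_))
  exact isClosed_le (by fun_prop) continuous_const

/-- The Banach fixed point theorem for the distance `err`, which induces the topology of the
state space although it is not the distance of its product structure. -/
theorem exists_fixedPoint_of_err_le {Φ : State J n p T → State J n p T} {S : Set (State J n p T)}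
    (hS : IsClosed S) (hne : S.Nonempty) (hΦ : MapsTo Φ S S) {ν : ℝ} (hν0 : 0 ≤ ν) (hν : ν < 1)
    (h : ∀ z ∈ S, ∀ z' ∈ S, err (Φ z) (Φ z') ≤ ν * err z z') :
    ∃ zstar ∈ S, Φ zstar = zstar ∧ (∀ z ∈ S, Φ z = z → z = zstar) ∧
      ∀ z₀ ∈ S, Tendsto (fun k : ℕ => Φ^[k] z₀) atTop (𝓝 zstar) ∧
        ∀ k : ℕ, err (Φ^[k] z₀) zstar ≤ ν ^ k * err z₀ zstar := by
  have hmem : ∀ z ∈ S, ∀ k, Φ^[k] z ∈ S := fun z hz k => hΦ.iterate k hz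
  have hit : ∀ z ∈ S, ∀ z' ∈ S, ∀ k : ℕ, err (Φ^[k] z) (Φ^[k] z') ≤ ν ^ k * err z z' := by
    intro z hz z' hz' k
    induction k with
    | zero => simp
    | succ k ih =>
      rw [Function.iterate_succ_apply', Function.iterate_succ_apply', pow_succ', mul_assoc]
      exact (h _ (hmem z hz k) _ (hmem z' hz' k)).trans (mul_le_mul_of_nonneg_left ih hν0)
  obtain ⟨z₀, hz₀⟩ := hne
  have hcauchy : CauchySeq fun k : ℕ => Φ^[k] z₀ := by
    refine cauchySeq_of_le_geometric ν (err z₀ (Φ z₀)) hν fun k => ?_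
    rw [Function.iterate_succ_apply, mul_comm]
    exact (dist_le_err _ _).trans (hit z₀ hz₀ _ (hΦ hz₀) k)
  obtain ⟨zstar, hlim⟩ := cauchySeq_tendsto_of_complete hcauchy
  have hstar : zstar ∈ S := hS.mem_of_tendsto hlim (Eventually.of_forall (hmem z₀ hz₀))
  have hfix : Φ zstar = zstar := by
    have h1 : Tendsto (fun k : ℕ => Φ^[k + 1] z₀) atTop (𝓝 zstar) :=
      hlim.comp (tendsto_add_atTop_nat 1)
    refine tendsto_nhds_unique ?_ h1
    rw [tendsto_iff_dist_tendsto_zero]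
    have h2 : Tendsto (fun k : ℕ => ν * err (Φ^[k] z₀) zstar) atTop (𝓝 0) := by
      have := (((continuous_err_left zstar).tendsto zstar).comp hlim).const_mul ν
      rwa [err_self, mul_zero] at this
    refine squeeze_zero (fun _ => dist_nonneg) (fun k => ?_) h2
    rw [Function.iterate_succ_apply']
    exact (dist_le_err _ _).trans (h _ (hmem z₀ hz₀ k) _ hstar)
  have hrate : ∀ z ∈ S, ∀ k : ℕ, err (Φ^[k] z) zstar ≤ ν ^ k * err z zstar := fun z hz k => by
    simpa only [Function.iterate_fixed hfix k] using hit z hz zstar hstar k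
  refine ⟨zstar, hstar, hfix, fun z hz hzf => ?_, fun z hz => ⟨?_, hrate z hz⟩⟩
  · have h1 := h z hz zstar hstar
    rw [hzf, hfix] at h1
    have h2 := dist_le_err z zstar
    have h3 : err z zstar ≤ 0 := by nlinarith [dist_nonneg (x := z) (y := zstar)]
    exact dist_le_zero.1 (h2.trans h3)
  · rw [tendsto_iff_dist_tendsto_zero]
    refine squeeze_zero (fun _ => dist_nonneg)
      (fun k => (dist_le_err _ _).trans (hrate z hz k)) ?_
    simpa using (tendsto_pow_atTop_nhds_zero_of_lt_one hν0 hν).mul_const (err z zstar)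

end Err

/-! ### Contraction of the algorithm -/

section Contraction

variable {n p q N J : ℕ} {T : ℝ}

/-- The smallness condition on `T` in terms of real numbers. It forces `a`, hence `X`, to be
nontrivial and both suprema to be finite. -/
theorem small_time {f : ℝ → Euc n → Euc p → Euc n} {S : Set ℝ} {Θ : Set (Euc p)} {a : ℝ}
    (h : ENNReal.ofReal T <
      min (1 / lipX f S Θ a) (ENNReal.ofReal a / (2 * supF f S Θ a))) :
    0 < a ∧ lipX f S Θ a ≠ ⊤ ∧ supF f S Θ a ≠ ⊤ ∧ T * (lipX f S Θ a).toReal < 1 ∧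
      2 * (T * (supF f S Θ a).toReal) < a := by
  obtain ⟨h1, h2⟩ := lt_min_iff.1 h
  have ha : 0 < a := by
    by_contra hle
    rw [ENNReal.ofReal_of_nonpos (not_lt.1 hle), ENNReal.zero_div] at h2
    exact not_lt_zero h2
  have hK : lipX f S Θ a ≠ ⊤ := by
    intro hK
    rw [hK, ENNReal.div_top] at h1
    exact not_lt_zero h1
  have hM : supF f S Θ a ≠ ⊤ := by
    intro hM
    rw [hM, ENNReal.mul_top two_ne_zero, ENNReal.div_top] at h2
    exact not_lt_zero h2
  refine ⟨ha, hK, hM, ?_, ?_⟩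
  · rcases (ENNReal.toReal_nonneg (a := lipX f S Θ a)).eq_or_lt with h0 | h0
    · rw [← h0]; simp
    · rw [← ENNReal.ofReal_toReal hK, ← ENNReal.ofReal_one, ← ENNReal.ofReal_div_of_pos h0,
        ENNReal.ofReal_lt_ofReal_iff (by positivity)] at h1
      exact (lt_div_iff₀ h0).1 h1
  · rcases (ENNReal.toReal_nonneg (a := supF f S Θ a)).eq_or_lt with h0 | h0
    · rw [← h0]; simpa using ha
    · have e : (2 : ℝ≥0∞) * supF f S Θ a = ENNReal.ofReal (2 * (supF f S Θ a).toReal) := by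
        rw [ENNReal.ofReal_mul zero_le_two, ENNReal.ofReal_toReal hM, ENNReal.ofReal_ofNat]
      rw [e, ← ENNReal.ofReal_div_of_pos (by positivity),
        ENNReal.ofReal_lt_ofReal_iff (by positivity), lt_div_iff₀ (by positivity)] at h2
      linarith

theorem norm_le_half_radius {X : Set (Euc n)} (hX : IsCompact X) {x : Euc n} (hx : x ∈ X) :
    ‖x‖ ≤ radius X / 2 := by
  have h := le_csSup (hX.image continuous_norm).bddAbove (mem_image_of_mem _ hx)
  rw [radius, mul_div_cancel_left₀ _ two_ne_zero]
  exact h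

/-- Choice of the step sizes and the order. The step size `α` makes the gradient step contract by
some `κ < 1`; then `σ` is small enough for the feedback `σ C` of the gradient step into the
trajectories not to spoil this; last, `m` is large enough for the trajectories to have next to no
influence on the gradient. -/
theorem exists_step_sizes {μ c C ρ k : ℝ} (hμ : 0 < μ) (hC : 0 < C) (hρ0 : 0 ≤ ρ) (hρ : ρ < 1)
    (hk : k < 1) :
    ∃ (α σ κ : ℝ) (m : ℕ) (ν : ℝ), 0 < α ∧ σ ∈ Ioc (0 : ℝ) 1 ∧ 0 ≤ κ ∧
      1 - 2 * α * μ + α ^ 2 * c ^ 2 ≤ κ ^ 2 ∧ 1 ≤ m ∧ 0 ≤ ν ∧ ν < 1 ∧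
      (1 + σ * C) * κ ≤ ν ∧ (1 + σ * C) * (α * (c * ρ ^ m)) + (1 - σ + σ * k) ≤ ν := by
  obtain ⟨α, hα, hαc, hα1⟩ : ∃ α : ℝ, 0 < α ∧ α * c ^ 2 ≤ μ ∧ α * μ ≤ 1 := by
    have h0 : 0 < c ^ 2 + μ ^ 2 := by positivity
    refine ⟨μ / (c ^ 2 + μ ^ 2), by positivity, ?_, ?_⟩
    · rw [div_mul_eq_mul_div, div_le_iff₀ h0]
      nlinarith [mul_pos hμ (pow_pos hμ 2)]
    · rw [div_mul_eq_mul_div, div_le_iff₀ h0]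
      nlinarith [sq_nonneg c]
  obtain ⟨κ, hκ0, hκ1, hκ⟩ : ∃ κ : ℝ, 0 ≤ κ ∧ κ < 1 ∧
      1 - 2 * α * μ + α ^ 2 * c ^ 2 ≤ κ ^ 2 := by
    have h1 : 0 < α * μ := mul_pos hα hμ
    refine ⟨√(1 - α * μ), Real.sqrt_nonneg _, ?_, ?_⟩
    · rw [Real.sqrt_lt' one_pos]; linarith
    · rw [Real.sq_sqrt (by linarith)]
      nlinarith
  obtain ⟨σ, hσ, hσκ⟩ : ∃ σ : ℝ, σ ∈ Ioc (0 : ℝ) 1 ∧ (1 + σ * C) * κ < 1 := by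
    have h0 : 0 < (1 - κ) / C := div_pos (by linarith) hC
    refine ⟨min 1 ((1 - κ) / C), ⟨lt_min one_pos h0, min_le_left _ _⟩, ?_⟩
    have h1 : min 1 ((1 - κ) / C) * C ≤ 1 - κ := by
      rw [← le_div_iff₀ hC]; exact min_le_right _ _
    nlinarith
  have hlim : Tendsto (fun m : ℕ => (1 + σ * C) * (α * (c * ρ ^ m)) + (1 - σ + σ * k)) atTop
      (𝓝 ((1 + σ * C) * (α * (c * 0)) + (1 - σ + σ * k))) :=
    ((((tendsto_pow_atTop_nhds_zero_of_lt_one hρ0 hρ).const_mul c).const_mul α).const_mul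
      (1 + σ * C)).add_const _
  have hlt : (1 + σ * C) * (α * (c * 0)) + (1 - σ + σ * k) < 1 := by nlinarith [hσ.1]
  obtain ⟨m, hm, hm1⟩ := ((hlim.eventually_lt_const hlt).and (eventually_ge_atTop 1)).exists
  refine ⟨α, σ, κ, m, max ((1 + σ * C) * κ) ((1 + σ * C) * (α * (c * ρ ^ m)) + (1 - σ + σ * k)),
    hα, hσ, hκ0, hκ, hm1, ?_, max_lt hσκ hm, le_max_left _ _, le_max_right _ _⟩
  exact le_max_of_le_left (mul_nonneg (by nlinarith [mul_pos hσ.1 hC]) hκ0)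

/-- A relaxed step in the trajectories composed with a step in the data. -/
theorem norm_relaxed_sub_le {G : Type*} [SeminormedAddCommGroup G] [NormedSpace ℝ G]
    {u u' v v' : G} {σ k δ r : ℝ} (hσ : σ ∈ Ioc (0 : ℝ) 1) (hu : ‖u - u'‖ ≤ r)
    (hv : ‖v - v'‖ ≤ k * r + δ) :
    ‖((1 - σ) • u + σ • v) - ((1 - σ) • u' + σ • v')‖ ≤ (1 - σ + σ * k) * r + σ * δ := by
  have e : ((1 - σ) • u + σ • v) - ((1 - σ) • u' + σ • v')
      = (1 - σ) • (u - u') + σ • (v - v') := by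
    rw [smul_sub, smul_sub]; abel
  have h1 : 0 ≤ 1 - σ := by linarith [hσ.2]
  rw [e]
  refine (norm_add_le _ _).trans ?_
  rw [norm_smul, norm_smul, Real.norm_of_nonneg h1, Real.norm_of_nonneg hσ.1.le]
  have h2 := mul_le_mul_of_nonneg_left hu h1
  have h3 := mul_le_mul_of_nonneg_left hv hσ.1.le
  linarith

theorem Icc_mul_subset (hT : 0 ≤ T) (j : Fin J) :
    Icc ((j : ℝ) * T) ((j : ℝ) * T + T) ⊆ Icc 0 ((J : ℝ) * T) := by
  have h1 : ((j : ℕ) : ℝ) + 1 ≤ J := by exact_mod_cast j.isLt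
  have h2 := mul_le_mul_of_nonneg_right h1 hT
  exact Icc_subset_Icc (by positivity) (by linarith)

/-- For suitable step sizes and order, the algorithm maps the domain into itself and contracts the
error. -/
theorem exists_step_contraction [NeZero J]
    {Γ : Set ℝ} {X : Set (Euc n)} {Θ : Set (Euc p)} (hΓ : IsCompact Γ)
    (hX : IsCompact X) (hXc : Convex ℝ X) (hXne : X.Nonempty)
    (hΘ : IsCompact Θ) (hΘc : Convex ℝ Θ) (hΘne : Θ.Nonempty) (hT : 0 ≤ T)
    {f : ℝ → Euc n → Euc p → Euc n} {g : ℝ → Euc n → Euc p → Euc q}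
    (hf : IsC1 f (Icc 0 ((J : ℝ) * T)) Θ) (hf' : HasLipschitzPartials f (Icc 0 ((J : ℝ) * T)) Θ)
    (hg : IsC1 g Γ Θ) (hg' : HasLipschitzPartials g Γ Θ)
    {a : ℝ} (ha : a = radius X)
    (hTsmall : ENNReal.ofReal T < min (1 / lipX f (Icc 0 ((J : ℝ) * T)) Θ a)
      (ENNReal.ofReal a / (2 * supF f (Icc 0 ((J : ℝ) * T)) Θ a)))
    {t : Fin N → ℝ} (ht : ∀ i, t i ∈ Γ) {y : Fin N → Euc q} {lam : ℝ}
    (hconv : UniformlyStronglyConvexLoss (J := J) hT f g t y lam X Θ a) :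
    ∃ (α σ : ℝ) (m : ℕ) (ν : ℝ), 0 < α ∧ σ ∈ Ioc (0 : ℝ) 1 ∧ 1 ≤ m ∧ 0 ≤ ν ∧ ν < 1 ∧
      MapsTo (step hT f g t y lam X Θ α σ m) (domain J T X Θ a) (domain J T X Θ a) ∧
      ∀ z ∈ domain J T X Θ a, ∀ z' ∈ domain J T X Θ a,
        err (step hT f g t y lam X Θ α σ m z) (step hT f g t y lam X Θ α σ m z')
          ≤ ν * err z z' := by
  obtain ⟨ha0, hK, hM, hTK, hTM⟩ := small_time hTsmall
  set S : Set ℝ := Icc 0 ((J : ℝ) * T) with hS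
  set k := (lipX f S Θ a).toReal with hk
  set M := (supF f S Θ a).toReal with hMdef
  have hk0 : 0 ≤ k := ENNReal.toReal_nonneg
  have hTk0 : 0 ≤ T * k := mul_nonneg hT hk0
  have hTM0 : 0 ≤ T * M := mul_nonneg hT ENNReal.toReal_nonneg
  obtain ⟨fx, fθ, c, hc, hfx, hfθ, hfd, hfc⟩ :=
    exists_partials (isCompact_Icc : IsCompact S) hΘ hΘc hf hf' a
  obtain ⟨gx, gθ, b, hb, -, -, -, hgb⟩ := exists_partials hΓ hΘ hΘc hg hg' a
  have hfs : ∀ s ∈ S, StateParamSmooth (Metric.closedBall 0 a) Θ (f s)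
      (fun x θ => fx (s, x, θ)) (fun x θ => fθ (s, x, θ)) k c := by
    intro s hs
    refine { hfc s hs with norm_dx_le := ?_, lip := ?_ }
    · exact fun x hx θ hθ => norm_deriv_le_lipX ha0 hK hfx hs hθ (fun z => hfd s hs z θ hθ) hx
    · intro x hx x' hx' θ hθ θ' hθ'
      have e1 := norm_sub_le_lipX hK hs hθ' hx' hx
      have e2 : ‖f s x θ' - f s x θ‖ ≤ c * ‖θ' - θ‖ := by
        simpa using (hfc s hs).lip x hx x hx θ hθ θ' hθ'
      rw [← sub_add_sub_cancel (f s x' θ') (f s x θ') (f s x θ)]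
      exact norm_add_le_of_le e1 e2
  -- The open ball of radius `a - T M` contains `X`, and Picard operators with initial state in it
  -- preserve the trajectories bounded by `a`.
  set B : Set (Euc n) := Metric.ball 0 (a - T * M) with hB
  have hXB : X ⊆ B := fun x hx => by
    have := norm_le_half_radius hX hx
    rw [← ha] at this
    rw [hB, mem_ball_zero_iff]
    linarith
  have hinv : ∀ (j : Fin J), ∀ x ∈ B, ∀ θ ∈ Θ, ∀ u : Traj T n, ‖u‖ ≤ a →
      ‖picard hT f ((j : ℝ) * T) x θ u‖ ≤ a := by
    intro j x hx θ hθ u hu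
    rw [hB, mem_ball_zero_iff] at hx
    exact norm_picard_le hT (Icc_mul_subset hT j) hf.continuousOn
      (fun s hs x hx θ hθ => norm_le_supF hM hs hθ hx) (by linarith) hθ hu
  obtain ⟨ρ, hρk, hρ1⟩ := exists_between hTK
  have hρ0 : 0 ≤ ρ := hTk0.trans hρk.le
  obtain ⟨L, hL0, hL⟩ := unifSmooth_loss hT (W := dataSet J B Θ) ht y lam hρ0 hb
    (fun w hw j => by
      have := hw.1 j
      rw [hB, mem_ball_zero_iff] at this
      linarith)
    (fun w hw => hw.2)
    (fun j s => exists_smoothFamily_iterate_picard hT (Icc_mul_subset hT j) hf.continuousOn hfx hfθ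
      ha0.le hk0 hc hfs hρk hρ1 (stateL j) (norm_stateL_le j) paramL norm_paramL_le
      (fun w hw => hw.2) (fun w hw u hu => hinv j _ (hw.1 j) _ hw.2 u hu) s)
    (fun j m w hw u hu => norm_iterate_picard_le hT (hinv j _ (hw.1 j) _ hw.2) hu m) hgb
  obtain ⟨μ, hμ, hconv⟩ := hconv
  obtain ⟨α, σ, κ, m, ν, hα, hσ, hκ0, hκ, hm, hν0, hν1, hν, hν'⟩ :=
    exists_step_sizes (c := L) hμ (C := 1 + T * c) (by positivity) hρ0 hρ1 hTK
  obtain ⟨D, hD⟩ := hL m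
  have hsub : dataSet J X Θ ⊆ dataSet J B Θ := fun w hw => ⟨fun j => hXB (hw.1 j), hw.2⟩
  have hdata : ∀ z ∈ domain J T X Θ a, mkData z.1 z.2.1 ∈ dataSet J X Θ :=
    fun z hz => ⟨hz.1, hz.2.1⟩
  have hmaps : MapsTo (step hT f g t y lam X Θ α σ m) (domain J T X Θ a) (domain J T X Θ a) := by
    intro z hz
    have hx' : ∀ j, (step hT f g t y lam X Θ α σ m z).1 j ∈ X := fun j =>
      (proj_spec hX hXne _).1
    have hθ' : (step hT f g t y lam X Θ α σ m z).2.1 ∈ Θ := (proj_spec hΘ hΘne _).1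
    refine ⟨hx', hθ', fun j => ?_⟩
    have h1 := hinv j _ (hXB (hx' j)) _ hθ' _ (hz.2.2 j)
    have h2 := convex_closedBall (0 : Traj T n) a (mem_closedBall_zero_iff.2 (hz.2.2 j))
      (mem_closedBall_zero_iff.2 h1) (by linarith [hσ.2] : 0 ≤ 1 - σ) hσ.1.le (by ring)
    exact mem_closedBall_zero_iff.1 h2
  refine ⟨α, σ, m, ν, hα, hσ, hm, hν0, hν1, hmaps, fun z hz z' hz' => ?_⟩
  rw [err_eq, err_eq]
  set w := mkData z.1 z.2.1 with hw
  set w' := mkData z'.1 z'.2.1 with hw'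
  set zn := step hT f g t y lam X Θ α σ m z with hzn
  set zn' := step hT f g t y lam X Θ α σ m z' with hzn'
  have hznd := hmaps hz
  have hznd' := hmaps hz'
  set v := mkData zn.1 zn.2.1 with hv
  set v' := mkData zn'.1 zn'.2.1 with hv'
  have hwm := hdata z hz
  have hwm' := hdata z' hz'
  have i1 : inner ℝ (w - v) (v' - v) ≤ α * D w z.2.2 (v' - v) :=
    inner_step_le hT hX hXc hXne hΘ hΘc hΘne Metric.isOpen_ball hXB hD α σ hz (hdata _ hznd')
  have i2 : inner ℝ (w' - v') (v - v') ≤ α * D w' z'.2.2 (v - v') :=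
    inner_step_le hT hX hXc hXne hΘ hΘc hΘne Metric.isOpen_ball hXB hD α σ hz' (hdata _ hznd)
  have hconv' : ConvexOn ℝ (dataSet J X Θ) fun w : Data J n p =>
      loss hT f g t y lam m (fun j => stateL j w) (paramL w) z.2.2 - μ / 2 * ‖w‖ ^ 2 := by
    let A : Data J n p →ₗ[ℝ] (Fin J → Euc n) × Euc p :=
      (LinearMap.pi fun j => (stateL j).toLinearMap).prod paramL.toLinearMap
    have h1 := (hconv m hm z.2.2 hz.2.2).comp_linearMap A
    have e1 : A ⁻¹' ((univ.pi fun _ : Fin J => X) ×ˢ Θ) = dataSet J X Θ := by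
      ext w; simp [A, dataSet]
    rw [e1] at h1
    refine h1.congr fun w _ => ?_
    have e2 : ‖w‖ ^ 2 = (∑ j, ‖stateL j w‖ ^ 2) + ‖paramL w‖ ^ 2 :=
      norm_sq_mkData (fun j => stateL j w) (paramL w)
    rw [e2]
    rfl
  have i3 : μ * ‖w - w'‖ ^ 2 ≤ (D w z.2.2 - D w' z.2.2) (w - w') :=
    strongly_monotone_of_strongConvexOn (D := fun w => D w z.2.2) hconv'
      (fun w hw v hv => hD.remainder w (hsub hw) v (hsub hv) _ hz.2.2) hwm' hwm
  have i4 : ‖D w z.2.2 - D w' z.2.2‖ ≤ L * ‖w - w'‖ := by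
    simpa using hD.lip_deriv w' (hsub hwm') w (hsub hwm) _ hz.2.2 _ hz.2.2
  have i5 : ‖D w' z.2.2 - D w' z'.2.2‖ ≤ L * ρ ^ m * ‖z.2.2 - z'.2.2‖ := by
    simpa using hD.lip_deriv w' (hsub hwm') w' (hsub hwm') _ hz'.2.2 _ hz.2.2
  have i6 : ‖v - v'‖ ≤ κ * ‖w - w'‖ + α * (L * ρ ^ m * ‖z.2.2 - z'.2.2‖) :=
    norm_projected_step_sub_le hα.le hκ0 hκ i2 i1 i3 i4 i5
  have i7 : ‖zn.2.2 - zn'.2.2‖ ≤ (1 - σ + σ * (T * k)) * ‖z.2.2 - z'.2.2‖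
      + σ * ((1 + T * c) * ‖v - v'‖) := by
    have hnn : 0 ≤ (1 - σ + σ * (T * k)) * ‖z.2.2 - z'.2.2‖ + σ * ((1 + T * c) * ‖v - v'‖) := by
      have := hσ.1
      have : 0 ≤ 1 - σ := by linarith [hσ.2]
      positivity
    refine (pi_norm_le_iff_of_nonneg hnn).2 fun j => ?_
    have j0 : ‖z.2.2 j - z'.2.2 j‖ ≤ ‖z.2.2 - z'.2.2‖ := norm_le_pi_norm (z.2.2 - z'.2.2) j
    have j1 : ‖zn.1 j - zn'.1 j‖ ≤ ‖v - v'‖ := by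
      have := (stateL j).le_of_opNorm_le (norm_stateL_le j) (v - v')
      rwa [one_mul] at this
    have j2 : ‖zn.2.1 - zn'.2.1‖ ≤ ‖v - v'‖ := by
      have := paramL.le_of_opNorm_le norm_paramL_le (v - v')
      rwa [one_mul] at this
    refine norm_relaxed_sub_le hσ j0 ?_
    refine (norm_picard_sub_le hT (Icc_mul_subset hT j) hf.continuousOn hk0 hfs (zn'.1 j) (zn.1 j)
      hznd'.2.1 hznd.2.1 (hz'.2.2 j) (hz.2.2 j)).trans ?_
    have j3 : T * (k * ‖z.2.2 j - z'.2.2 j‖ + c * ‖zn.2.1 - zn'.2.1‖)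
        ≤ T * (k * ‖z.2.2 - z'.2.2‖ + c * ‖v - v'‖) := by gcongr
    linarith
  have i8 : 0 ≤ 1 + σ * (1 + T * c) := by
    have := hσ.1
    positivity
  have i9 := mul_le_mul_of_nonneg_left i6 i8
  have i10 := mul_le_mul_of_nonneg_right hν (norm_nonneg (w - w'))
  have i11 := mul_le_mul_of_nonneg_right hν' (norm_nonneg (z.2.2 - z'.2.2))
  linarith

end Contraction

end ParamEst

end

theorem mainTheorem1 (n p q N J : ℕ) [NeZero J] (hN : 0 < N)
    (Γ : Set ℝ) (X : Set (ParamEst.Euc n)) (Θ : Set (ParamEst.Euc p))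
    (hΓ : IsCompact Γ) (hΓc : Convex ℝ Γ)
    (hX : IsCompact X) (hXc : Convex ℝ X) (hXne : X.Nonempty)
    (hΘ : IsCompact Θ) (hΘc : Convex ℝ Θ) (hΘne : Θ.Nonempty)
    (T : ℝ) (hT : 0 < T) (hΓJ : Γ ⊆ Icc 0 ((J : ℝ) * T))
    (f : ℝ → ParamEst.Euc n → ParamEst.Euc p → ParamEst.Euc n)
    (g : ℝ → ParamEst.Euc n → ParamEst.Euc p → ParamEst.Euc q)
    (hf : ParamEst.IsC1 f (Icc 0 ((J : ℝ) * T)) Θ)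
    (hf' : ParamEst.HasLipschitzPartials f (Icc 0 ((J : ℝ) * T)) Θ)
    (hg : ParamEst.IsC1 g Γ Θ) (hg' : ParamEst.HasLipschitzPartials g Γ Θ)
    (a : ℝ) (ha : a = ParamEst.radius X)
    (hTsmall : ENNReal.ofReal T <
      min (1 / ParamEst.lipX f (Icc 0 ((J : ℝ) * T)) Θ a)
        (ENNReal.ofReal a / (2 * ParamEst.supF f (Icc 0 ((J : ℝ) * T)) Θ a)))
    (t : Fin N → ℝ) (ht : ∀ i, t i ∈ Γ) (y : Fin N → ParamEst.Euc q)
    (lam : ℝ) (hlam : 0 < lam)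
    (hconv : ParamEst.UniformlyStronglyConvexLoss (J := J) hT.le f g t y lam X Θ a) :
    ∃ (α σ : ℝ) (m : ℕ) (ν : ℝ) (zstar : ParamEst.State J n p T),
      0 < α ∧ σ ∈ Ioc (0 : ℝ) 1 ∧ 1 ≤ m ∧ 0 ≤ ν ∧ ν < 1 ∧
      zstar ∈ ParamEst.domain J T X Θ a ∧
      ParamEst.step hT.le f g t y lam X Θ α σ m zstar = zstar ∧
      (∀ z ∈ ParamEst.domain J T X Θ a,
        ParamEst.step hT.le f g t y lam X Θ α σ m z = z → z = zstar) ∧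
      ∀ z₀ ∈ ParamEst.domain J T X Θ a,
        Tendsto (fun k : ℕ => (ParamEst.step hT.le f g t y lam X Θ α σ m)^[k] z₀) atTop (𝓝 zstar) ∧
        ∀ k : ℕ, ParamEst.err ((ParamEst.step hT.le f g t y lam X Θ α σ m)^[k] z₀) zstar ≤
          ν ^ k * ParamEst.err z₀ zstar := by
  obtain ⟨α, σ, m, ν, hα, hσ, hm, hν0, hν1, hmaps, hcontr⟩ :=
    ParamEst.exists_step_contraction hΓ hX hXc hXne hΘ hΘc hΘne hT.le hf hf' hg hg' ha hTsmall ht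
      hconv
  have ha0 : 0 < a := (ParamEst.small_time hTsmall).1
  have hne : (ParamEst.domain J T X Θ a).Nonempty := by
    obtain ⟨x, hx⟩ := hXne
    obtain ⟨θ, hθ⟩ := hΘne
    exact ⟨(fun _ => x, θ, 0), fun _ => hx, hθ, fun _ => by simpa using ha0.le⟩
  obtain ⟨zstar, hz, hfix, huniq, hconv'⟩ := ParamEst.exists_fixedPoint_of_err_le
    (ParamEst.isClosed_domain hX.isClosed hΘ.isClosed a) hne hmaps hν0 hν1 hcontr
  exact ⟨α, σ, m, ν, zstar, hα, hσ, hm, hν0, hν1, hz, hfix, huniq, hconv'⟩
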